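/- Let $a\in\mathcal S'(\mathbb R^n\times\mathbb R^n)$ and let $\hat a:\mathcal S(\mathbb R^n)\to\mathcal S'(\mathbb R^n)$ be the Weyl operator $$\hat a\psi(x)=\frac1{(2\pi)^n}\int_{\mathbb R^{2n}} e^{i(x-x')\cdot k}\,a\big(\tfrac12(x+x'),k\big)\psi(x')\,dx'\,dk ,$$ and $\hat A:\mathcal S(\mathbb R^{2n})\to\mathcal S'(\mathbb R^{2n})$ its extension to functions $\Psi(x,p)$ on phase space, $$\hat A\Psi(x,p)=\frac1{(2\pi)^n}\int_{\mathbb R^{2n}} e^{i(x-x')\cdot k}\,a\big(\tfrac12(x+x'),k\big)\Psi(x',p)\,dx'\,dk ,$$ both understood in the distributional sense. Let $\mathcal F$ be the unitary partial Fourier transform $p\to\xi$, $\mathcal F\Psi(x,\xi)=(2\pi)^{-n/2}\int e^{-i\xi\cdot p}\Psi(x,p)\,dp$. For $\theta\in\mathbb R$ put $\hat U(\theta)=\mathcal F^{-1}\hat T(\theta)\mathcal F$, where $\hat T(\theta)\Phi(x,\xi)=\Phi(x(-\theta),\xi(-\theta))$ and, with $k=\sqrt7$, $$x(\theta)=x\big[\cos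 k\theta-k^{-1}\sin k\theta\big]+2k^{-1}\xi\sin k\theta,\qquad \xi(\theta)=\xi\big[\cos k\theta+k^{-1}\sin k\theta\big]-4k^{-1}x\sin k\theta .$$ Let $\hat S=\hat U(\theta_0)$ with $\theta_0=\frac{\sqrt7}{7}\arccos\frac34$, so that $\hat S^{-1}=\hat U(-\theta_0)$; these operators act on $\mathcal S(\mathbb R^{2n})$ and, by duality, on $\mathcal S'(\mathbb R^{2n})$. The Bopp operator is $\hat A_B=\hat S\hat A\hat S^{-1}:\mathcal S(\mathbb R^{2n})\to\mathcal S'(\mathbb R^{2n})$. For a window $\phi\in\mathcal S(\mathbb R^n)$ with $\|\phi\|_{L^2}=1$ let $W_\phi\psi(x,p)=(2\pi)^{-n/2}\int e^{ip\cdot y}\psi(x-\frac y2)\overline{\phi(x+\frac y2)}\,dy$ for $\psi\in\mathcal S(\mathbb R^n)$ be the windowed Wigner transform, and let $W_\phi^*\Psi(x)=\int\hat\phi(p)\,(\hat S^{-1}\Psi)(x,p)\,dp$ for $\Psi\in\mathcal S(\mathbb R^{2n})$, where $\hat\phi$ is the unitary Fourier transform of $\phi$. On tempered distributions let $W_\phi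 u=\hat S(u\otimes\overline{\hat\phi})$ and $\langle W_\phi^*u,\xi\rangle=\langle \hat S^{-1}u,\xi\otimes\hat\phi\rangle$ for $\xi\in\mathcal S(\mathbb R^n)$. An eigenfunction of $\hat a$ (resp. $\hat A_B$) with eigenvalue $\mu\in\mathbb C$ is a nonzero $\psi\in\mathcal S(\mathbb R^n)$ with $\hat a\psi=\mu\psi$ (resp. a nonzero $\Psi\in\mathcal S(\mathbb R^{2n})$ with $\hat A_B\Psi=\mu\Psi$). A solution of $i\partial_tu=Tu$, $u(0)=u_0$ on an interval $J\ni0$, for $T=\hat a$ or $T=\hat A_B$, is a map $u$ from $J$ to the Schwartz space with $u(0)=u_0$ that satisfies the equation at every $t\in J$, the derivative being taken in the space of tempered distributions. Then: 0. For every window $\phi$ as above, the maps $W_\phi$ and $W_\phi^*$ on tempered distributions extend those on Schwartz functions; $(W_\phi^*\Psi,\xi)_{L^2}=(\Psi,W_\phi\xi)_{L^2}$ for $\Psi\in\mathcal S(\mathbb R^{2n})$, $\xi\in\mathcal S(\mathbb R^n)$; and $W_\phi^*W_\phi=1$ on $\mathcal S(\mathbb R^n)$. 1. (Intertwining.) For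 every window $\phi$ as above, $\hat A_BW_\phi=W_\phi\hat a$ on $\mathcal S(\mathbb R^n)$ and $W_\phi^*\hat A_B=\hat aW_\phi^*$ on $\mathcal S(\mathbb R^{2n})$. 2. (Spectral equivalence.) - (i) $\hat a$ and $\hat A_B$ have the same eigenvalues. - (ii) If $\psi$ is an eigenfunction of $\hat a$ with eigenvalue $\mu$, then $W_\phi\psi$ is an eigenfunction of $\hat A_B$ with eigenvalue $\mu$, for every window $\phi$ as above. - (iii) If $\Psi$ is an eigenfunction of $\hat A_B$ with eigenvalue $\mu$ and $W_\phi^*\Psi\neq0$, then $W_\phi^*\Psi$ is an eigenfunction of $\hat a$ with eigenvalue $\mu$, for every window $\phi$ as above. - (iv) If $(\psi_\lambda)_\lambda$ is an orthonormal basis of $L^2(\mathbb R^n)$ consisting of eigenfunctions of $\hat a$ and $(\phi_\gamma)_\gamma\subset\mathcal S(\mathbb R^n)$ is an orthonormal basis of $L^2(\mathbb R^n)$, then the functions $W_{\phi_\gamma}\psi_\lambda$ are eigenfunctions of $\hat A_B$ (each with the eigenvalue of $\psi_\lambda$) and $(W_{\phi_\gamma}\psi_\lambda)_{\gamma,\lambda}$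 is an orthonormal basis of $L^2(\mathbb R^{2n})$. 3. (Dynamical equivalence.) Let $\phi$ be a window as above and $J\ni0$ an interval. - (i) If $\psi$ is a solution of $i\partial_t\psi=\hat a\psi$, $\psi(0)=\psi_0\in\mathcal S(\mathbb R^n)$, then $W_\phi\psi$ is a solution of $i\partial_t\Psi=\hat A_B\Psi$, $\Psi(0)=W_\phi\psi_0$; if $\psi$ is the only solution of the first problem, then $W_\phi\psi$ is the only solution of the second. - (ii) Conversely, if $\Psi$ is a solution of $i\partial_t\Psi=\hat A_B\Psi$, $\Psi(0)=\Psi_0\in\mathcal S(\mathbb R^{2n})$, then $W_\phi^*\Psi$ is a solution of $i\partial_t\psi=\hat a\psi$, $\psi(0)=W_\phi^*\Psi_0$ (which is $\psi_0$ if $\Psi_0=W_\phi\psi_0$); if $\Psi$ is the only solution of the first problem, then $W_\phi^*\Psi$ is the only solution of the second. -/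

import Mathlib

open MeasureTheory SchwartzMap
open scoped FourierTransform RealInnerProductSpace ContDiff

noncomputable section
namespace Bopp

section Partial
variable {V E : Type} {F : Type} [NormedAddCommGroup V] [NormedSpace ℝ V]
  [NormedAddCommGroup E] [InnerProductSpace ℝ E] [FiniteDimensional ℝ E]
  [MeasurableSpace E] [BorelSpace E] [NormedAddCommGroup F] [NormedSpace ℝ F]
  [NormedSpace ℂ F] [IsScalarTower ℝ ℂ F] [SMulCommClass ℝ ℂ F]

set_option linter.unusedSectionVars false

/-- The partial Fourier integral in the second variable, without normalisation. -/
def pft (f : V × E → F) (z : V × E) : F :=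
  ∫ p : E, Complex.exp ((-⟪p, z.2⟫ : ℝ) * Complex.I) • f (z.1, p)

lemma norm_exp_smul (t : ℝ) (y : F) : ‖Complex.exp ((t : ℝ) * Complex.I) • y‖ = ‖y‖ := by
  rw [norm_smul, Complex.norm_exp_ofReal_mul_I, one_mul]

lemma schwartz_decay (f : 𝓢(V × E, F)) (k m n : ℕ) (v : V) (p : E) :
    (1 + ‖((v, p) : V × E)‖) ^ k * ‖iteratedFDeriv ℝ n f (v, p)‖ ≤
      (2 ^ (k + m) * (Finset.Iic (k + m, n)).sup (schwartzSeminormFamily ℂ (V × E) F) f) *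
        (1 + ‖p‖) ^ (-(m : ℝ)) := by
  have h := one_add_le_sup_seminorm_apply (𝕜 := ℂ) (m := (k + m, n)) le_rfl le_rfl f (v, p)
  have hp : ‖p‖ ≤ ‖((v, p) : V × E)‖ := le_max_right _ _
  have h1 : (0 : ℝ) < (1 + ‖p‖) ^ m := by positivity
  rw [Real.rpow_neg (by positivity), Real.rpow_natCast, ← div_eq_mul_inv, le_div_iff₀ h1]
  refine le_trans ?_ h
  rw [pow_add, mul_right_comm]
  gcongr

variable (E) in
abbrev decayExp : ℕ := (volume : Measure E).integrablePower

lemma integrable_decay : Integrable (fun p : E => (1 + ‖p‖) ^ (-(decayExp E : ℝ))) :=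
  Measure.integrable_pow_neg_integrablePower _

lemma slice_integrable (f : 𝓢(V × E, F)) (z : V × E) :
    Integrable (fun p : E => Complex.exp ((-⟪p, z.2⟫ : ℝ) * Complex.I) • f (z.1, p)) := by
  refine (integrable_decay.const_mul
    (2 ^ (0 + decayExp E) * (Finset.Iic (0 + decayExp E, 0)).sup
      (schwartzSeminormFamily ℂ (V × E) F) f)).mono' ?_ (Filter.Eventually.of_forall fun p => ?_)
  · have := f.continuous
    exact Continuous.aestronglyMeasurable (by fun_prop)
  · rw [norm_exp_smul]
    simpa using schwartz_decay f 0 (decayExp E) 0 z.1 p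


variable (V E F) in
/-- Restriction of a real linear map on `V × E` to the first factor. -/
def restrictFst : (V × E →L[ℝ] F) →L[ℂ] (V × E →L[ℝ] F) where
  toFun L := L.comp ((ContinuousLinearMap.inl ℝ V E).comp (ContinuousLinearMap.fst ℝ V E))
  map_add' L M := by ext <;> simp
  map_smul' c L := by ext <;> simp
  cont := by fun_prop

variable (V E F) in
/-- The Schwartz function under the integral that gives the derivative of the partial Fourier
integral. -/
def pftDeriv : 𝓢(V × E, F) →L[ℂ] 𝓢(V × E, V × E →L[ℝ] F) :=
  (SchwartzMap.postcompCLM (restrictFst V E F)).comp (fderivCLM ℂ (V × E) F)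
  - Complex.I • SchwartzMap.smulRightCLM ℂ F
      ((innerSL ℝ).bilinearComp (ContinuousLinearMap.snd ℝ V E) (ContinuousLinearMap.snd ℝ V E))

lemma pftDeriv_apply (f : 𝓢(V × E, F)) (z w : V × E) :
    pftDeriv V E F f z w = fderiv ℝ f z (w.1, 0) - Complex.I • (⟪z.2, w.2⟫ • f z) := by
  simp [pftDeriv, restrictFst]

lemma hasFDerivAt_slice (f : 𝓢(V × E, F)) (p : E) (z : V × E) :
    HasFDerivAt (fun z : V × E => Complex.exp ((-⟪p, z.2⟫ : ℝ) * Complex.I) • f (z.1, p))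
      (Complex.exp ((-⟪p, z.2⟫ : ℝ) * Complex.I) • pftDeriv V E F f (z.1, p)) z := by
  have h1 : HasFDerivAt (fun z : V × E => f (z.1, p))
      ((fderiv ℝ f (z.1, p)).comp
        ((ContinuousLinearMap.inl ℝ V E).comp (ContinuousLinearMap.fst ℝ V E))) z := by
    have hf := (f.differentiableAt (x := (z.1, p))).hasFDerivAt
    have hg : HasFDerivAt (fun z : V × E => (z.1, p))
        ((ContinuousLinearMap.inl ℝ V E).comp (ContinuousLinearMap.fst ℝ V E)) z := by
      have := (hasFDerivAt_fst (𝕜 := ℝ) (p := z)).prodMk (hasFDerivAt_const p z)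
      convert! this using 1
    exact hf.comp z hg
  have h2 : HasFDerivAt (fun z : V × E => (-⟪p, z.2⟫ : ℝ))
      (-((innerSL ℝ p).comp (ContinuousLinearMap.snd ℝ V E))) z :=
    ((innerSL ℝ p).comp (ContinuousLinearMap.snd ℝ V E)).hasFDerivAt.neg
  have h3 : HasFDerivAt (fun z : V × E => Complex.exp ((-⟪p, z.2⟫ : ℝ) * Complex.I)) _ z :=
    ((Complex.ofRealCLM.hasFDerivAt.comp z h2).mul_const Complex.I).cexp
  refine (h3.smul h1).congr_fderiv ?_
  ext w
  all_goals
    simp [pftDeriv_apply, smul_sub, smul_smul]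
  rw [← algebraMap_smul ℂ (⟪p, w⟫) (f (z.1, p)), smul_smul, ← sub_eq_add_neg]
  rfl

lemma hasFDerivAt_pft (f : 𝓢(V × E, F)) (z : V × E) :
    HasFDerivAt (pft f) (pft (pftDeriv V E F f) z) z := by
  refine hasFDerivAt_integral_of_dominated_of_fderiv_le (s := Set.univ) Filter.univ_mem
    (F' := fun z p => Complex.exp ((-⟪p, z.2⟫ : ℝ) * Complex.I) • pftDeriv V E F f (z.1, p))
    (Filter.Eventually.of_forall fun z => (slice_integrable f z).aestronglyMeasurable)
    (slice_integrable f z) (slice_integrable (pftDeriv V E F f) z).aestronglyMeasurable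
    (Filter.Eventually.of_forall fun p z _ => ?_)
    (integrable_decay.const_mul
      (2 ^ (0 + decayExp E) * (Finset.Iic (0 + decayExp E, 0)).sup
        (schwartzSeminormFamily ℂ (V × E) (V × E →L[ℝ] F)) (pftDeriv V E F f)))
    (Filter.Eventually.of_forall fun p z _ => hasFDerivAt_slice f p z)
  refine (norm_exp_smul (F := V × E →L[ℝ] F) _ _).trans_le ?_
  simpa using schwartz_decay (pftDeriv V E F f) 0 (decayExp E) 0 z.1 p

lemma contDiff_pft_nat (n : ℕ) : ∀ {F : Type} [NormedAddCommGroup F] [NormedSpace ℝ F]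
    [NormedSpace ℂ F] [IsScalarTower ℝ ℂ F] [SMulCommClass ℝ ℂ F] (f : 𝓢(V × E, F)), ContDiff ℝ n (pft f) := by
  induction n with
  | zero =>
    intro F _ _ _ _ _ f
    have : Continuous (pft f) := continuous_iff_continuousAt.2 fun z =>
      (hasFDerivAt_pft f z).continuousAt
    simpa using this
  | succ n ih =>
    intro F _ _ _ _ _ f
    exact_mod_cast contDiff_succ_iff_hasFDerivAt.2 ⟨_, ih (pftDeriv V E F f), hasFDerivAt_pft f⟩

lemma contDiff_pft (f : 𝓢(V × E, F)) : ContDiff ℝ ∞ (pft f) :=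
  contDiff_infty.2 fun n => contDiff_pft_nat n f

lemma norm_iteratedFDeriv_slice_le (f : 𝓢(V × E, F)) (n : ℕ) (v : V) (p : E) :
    ‖iteratedFDeriv ℝ n (fun p => f (v, p)) p‖ ≤ ‖iteratedFDeriv ℝ n f (v, p)‖ := by
  have h0 : (fun p => f (v, p)) =
      (fun z => f ((v, 0) + z)) ∘ (ContinuousLinearMap.inr ℝ V E) := by
    ext p; simp
  have hs : ContDiff ℝ n (fun z => f ((v, 0) + z)) :=
    (f.smooth n).comp (contDiff_const.add contDiff_id)
  rw [h0, ContinuousLinearMap.iteratedFDeriv_comp_right _ hs p le_rfl]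
  refine (ContinuousMultilinearMap.norm_compContinuousLinearMap_le _ _).trans ?_
  have h1 : iteratedFDeriv ℝ n (fun z => f ((v, 0) + z)) (ContinuousLinearMap.inr ℝ V E p) =
      iteratedFDeriv ℝ n f (v, p) := by
    rw [iteratedFDeriv_comp_add_left]; simp
  rw [h1]
  refine mul_le_of_le_one_right (norm_nonneg _) (Finset.prod_le_one (by simp) fun _ _ => ?_)
  exact ContinuousLinearMap.norm_inr_le_one ℝ V E

/-- the constant in the decay estimate -/
abbrev cst (f : 𝓢(V × E, F)) (k n : ℕ) : ℝ :=
  2 ^ (k + decayExp E) *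
    (Finset.Iic (k + decayExp E, n)).sup (schwartzSeminormFamily ℂ (V × E) F) f

lemma slice_bound (f : 𝓢(V × E, F)) (k n : ℕ) (v : V) :
    ∫ p : E, (1 + ‖((v, p) : V × E)‖) ^ k * ‖iteratedFDeriv ℝ n f (v, p)‖ ≤
      cst f k n * ∫ p : E, (1 + ‖p‖) ^ (-(decayExp E : ℝ)) := by
  rw [← integral_const_mul]
  refine integral_mono_of_nonneg (Filter.Eventually.of_forall fun p => by positivity)
    (integrable_decay.const_mul _) (Filter.Eventually.of_forall fun p => ?_)
  exact schwartz_decay f k (decayExp E) n v p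


variable (E) in
abbrev decayInt : ℝ := ∫ p : E, (1 + ‖p‖) ^ (-(decayExp E : ℝ))

lemma decayInt_nonneg : 0 ≤ decayInt E := integral_nonneg fun p => by positivity

lemma fst_bound (f : 𝓢(V × E, F)) (k : ℕ) (z : V × E) :
    ‖z.1‖ ^ k * ‖pft f z‖ ≤ cst f k 0 * decayInt E := by
  refine le_trans ?_ (slice_bound f k 0 z.1)
  have : ‖pft f z‖ ≤ ∫ p : E, ‖f (z.1, p)‖ := by
    refine (norm_integral_le_integral_norm _).trans_eq ?_
    simp only [norm_exp_smul]
  refine (mul_le_mul_of_nonneg_left this (by positivity)).trans ?_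
  rw [← integral_const_mul]
  refine integral_mono_of_nonneg (Filter.Eventually.of_forall fun p => by positivity) ?_
    (Filter.Eventually.of_forall fun p => ?_)
  · refine (integrable_decay.const_mul (cst f k 0)).mono' ?_
      (Filter.Eventually.of_forall fun p => ?_)
    · have := f.continuous
      simp only [norm_iteratedFDeriv_zero]
      exact Continuous.aestronglyMeasurable (by fun_prop)
    · rw [Real.norm_of_nonneg (by positivity)]
      exact schwartz_decay f k (decayExp E) 0 z.1 p
  · simp only [norm_iteratedFDeriv_zero]
    have : ‖z.1‖ ≤ ‖(z.1, p)‖ := le_max_left _ _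
    gcongr
    linarith

lemma normedSpace_real_eq (F : Type) [NormedAddCommGroup F] [i : NormedSpace ℝ F]
    [NormedSpace ℂ F] [IsScalarTower ℝ ℂ F] : i = NormedSpace.complexToReal := by
  have h : ∀ (r : ℝ) (x : F), r • x = (r : ℂ) • x := fun r x =>
    (algebraMap_smul ℂ r x).symm
  have : i.toModule = (NormedSpace.complexToReal : NormedSpace ℝ F).toModule := by
    refine Module.ext' _ _ fun r x => ?_
    exact h r x
  rcases i with ⟨_⟩
  congr 1

lemma pft_eq_fourier {F : Type} [NormedAddCommGroup F] [NormedSpace ℂ F] (f : V × E → F)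
    (z : V × E) : pft f z = 𝓕 (fun p => f (z.1, p)) ((2 * Real.pi)⁻¹ • z.2) := by
  rw [Real.fourier_eq', pft]
  congr 1
  ext p
  have : (2 * Real.pi) ≠ 0 := by positivity
  rw [real_inner_smul_right]
  congr 4
  field_simp

lemma snd_bound_aux {F : Type} [NormedAddCommGroup F] [NormedSpace ℂ F] (f : 𝓢(V × E, F)) (k : ℕ)
    (z : V × E) :
    ‖z.2‖ ^ k * ‖pft f z‖ ≤ (2 * Real.pi) ^ k * (2 ^ k * ∑ n ∈ Finset.range (k + 1),
      cst f 0 n * decayInt E) := by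
  have hs : ∀ n, (fun p => ‖iteratedFDeriv ℝ n (fun p => f (z.1, p)) p‖) ≤
      fun p => ‖iteratedFDeriv ℝ n f (z.1, p)‖ := fun n p => norm_iteratedFDeriv_slice_le f n z.1 p
  have hcd : ContDiff ℝ ∞ (fun p => f (z.1, p)) := (f.smooth ⊤).comp (by fun_prop)
  have hint : ∀ (j n : ℕ), Integrable (fun p => ‖p‖ ^ j * ‖iteratedFDeriv ℝ n
      (fun p => f (z.1, p)) p‖) := by
    intro j n
    refine (integrable_decay.const_mul (cst f j n)).mono' ?_
      (Filter.Eventually.of_forall fun p => ?_)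
    · have := hcd.continuous_iteratedFDeriv (m := n) (mod_cast le_top)
      exact Continuous.aestronglyMeasurable (by fun_prop)
    · rw [Real.norm_of_nonneg (by positivity)]
      refine le_trans ?_ (schwartz_decay f j (decayExp E) n z.1 p)
      have : ‖p‖ ≤ ‖(z.1, p)‖ := le_max_right _ _
      have h2 := hs n p
      dsimp only at h2
      gcongr
      linarith
  have key := Real.pow_mul_norm_iteratedFDeriv_fourier_le (K := ⊤) (N := ⊤) (k := 0) (n := k) hcd
    (fun j n _ _ => hint j n) le_top le_top ((2 * Real.pi)⁻¹ • z.2)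
  rw [norm_iteratedFDeriv_zero, ← pft_eq_fourier, norm_smul, mul_pow] at key
  have hpi : (0 : ℝ) < 2 * Real.pi := by positivity
  have hsum : ∑ p ∈ Finset.range (0 + 1) ×ˢ Finset.range (k + 1),
        ∫ v, ‖v‖ ^ p.1 * ‖iteratedFDeriv ℝ p.2 (fun p => f (z.1, p)) v‖ ≤
      ∑ n ∈ Finset.range (k + 1), cst f 0 n * decayInt E := by
    rw [Finset.sum_product]
    simp only [zero_add, Finset.range_one, Finset.sum_singleton, pow_zero, one_mul]
    refine Finset.sum_le_sum fun n _ => le_trans ?_ (slice_bound f 0 n z.1)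
    have hi := hint 0 n
    simp only [pow_zero, one_mul] at hi ⊢
    refine integral_mono hi ?_ (hs n)
    refine (integrable_decay.const_mul (cst f 0 n)).mono' ?_
      (Filter.Eventually.of_forall fun p => ?_)
    · have := (f.smooth ⊤).continuous_iteratedFDeriv (m := n) (mod_cast le_top)
      exact Continuous.aestronglyMeasurable (by fun_prop)
    · rw [Real.norm_of_nonneg (by positivity)]
      have h0 := schwartz_decay f 0 (decayExp E) n z.1 p
      rwa [pow_zero, one_mul] at h0
  have key2 := key.trans (mul_le_mul_of_nonneg_left hsum (by positivity))
  rw [Real.norm_of_nonneg (by positivity)] at key2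
  calc ‖z.2‖ ^ k * ‖pft f z‖
      = (2 * Real.pi) ^ k * (((2 * Real.pi)⁻¹) ^ k * ‖z.2‖ ^ k * ‖pft f z‖) := by
        rw [inv_pow]; field_simp
    _ ≤ _ := by
        refine mul_le_mul_of_nonneg_left (key2.trans_eq ?_) (by positivity)
        simp

lemma snd_bound (f : 𝓢(V × E, F)) (k : ℕ) (z : V × E) :
    ‖z.2‖ ^ k * ‖pft f z‖ ≤ (2 * Real.pi) ^ k * (2 ^ k * ∑ n ∈ Finset.range (k + 1),
      cst f 0 n * decayInt E) := by
  obtain rfl := normedSpace_real_eq F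
  exact snd_bound_aux f k z

/-- A finite supremum of seminorms on Schwartz space bounds a functional. -/
def SBdd {X F : Type} [NormedAddCommGroup X] [NormedSpace ℝ X] [NormedAddCommGroup F]
    [NormedSpace ℝ F] [NormedSpace ℂ F] [SMulCommClass ℝ ℂ F] (Φ : 𝓢(X, F) → ℝ) : Prop :=
  ∃ (s : Finset (ℕ × ℕ)) (C : ℝ), 0 ≤ C ∧ ∀ f, Φ f ≤ C * s.sup (schwartzSeminormFamily ℂ X F) f

lemma SBdd.add {X F : Type} [NormedAddCommGroup X] [NormedSpace ℝ X] [NormedAddCommGroup F]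
    [NormedSpace ℝ F] [NormedSpace ℂ F] [SMulCommClass ℝ ℂ F] {Φ Ψ : 𝓢(X, F) → ℝ}
    (h₁ : SBdd Φ) (h₂ : SBdd Ψ) : SBdd fun f => Φ f + Ψ f := by
  obtain ⟨s, C, hC, h⟩ := h₁
  obtain ⟨t, D, hD, k⟩ := h₂
  refine ⟨s ∪ t, C + D, by positivity, fun f => ?_⟩
  have a1 : s.sup (schwartzSeminormFamily ℂ X F) f ≤ (s ∪ t).sup (schwartzSeminormFamily ℂ X F) f :=
    Finset.sup_mono (f := schwartzSeminormFamily ℂ X F) Finset.subset_union_left f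
  have a2 : t.sup (schwartzSeminormFamily ℂ X F) f ≤ (s ∪ t).sup (schwartzSeminormFamily ℂ X F) f :=
    Finset.sup_mono (f := schwartzSeminormFamily ℂ X F) Finset.subset_union_right f
  calc Φ f + Ψ f ≤ _ := add_le_add (h f) (k f)
    _ ≤ C * (s ∪ t).sup (schwartzSeminormFamily ℂ X F) f +
        D * (s ∪ t).sup (schwartzSeminormFamily ℂ X F) f := by gcongr
    _ = _ := by ring

lemma SBdd.const_mul {X F : Type} [NormedAddCommGroup X] [NormedSpace ℝ X] [NormedAddCommGroup F]
    [NormedSpace ℝ F] [NormedSpace ℂ F] [SMulCommClass ℝ ℂ F] {Φ : 𝓢(X, F) → ℝ}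
    (h₁ : SBdd Φ) {c : ℝ} (hc : 0 ≤ c) : SBdd fun f => c * Φ f := by
  obtain ⟨s, C, hC, h⟩ := h₁
  refine ⟨s, c * C, by positivity, fun f => ?_⟩
  rw [mul_assoc]
  exact mul_le_mul_of_nonneg_left (h f) hc

lemma SBdd.sum {X F : Type} [NormedAddCommGroup X] [NormedSpace ℝ X] [NormedAddCommGroup F]
    [NormedSpace ℝ F] [NormedSpace ℂ F] [SMulCommClass ℝ ℂ F] {Φ : ℕ → 𝓢(X, F) → ℝ}
    (h : ∀ n, SBdd (Φ n)) (t : Finset ℕ) : SBdd fun f => ∑ n ∈ t, Φ n f := by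
  classical
  induction t using Finset.induction_on with
  | empty => exact ⟨∅, 0, le_rfl, by simp⟩
  | insert a t ha ih => simpa [Finset.sum_insert ha] using (h a).add ih

lemma sBdd_cst (k n : ℕ) : SBdd fun f : 𝓢(V × E, F) => cst f k n :=
  ⟨_, 2 ^ (k + decayExp E), by positivity, fun _ => le_rfl⟩

lemma SBdd.comp {X F G : Type} [NormedAddCommGroup X] [NormedSpace ℝ X] [NormedAddCommGroup F]
    [NormedSpace ℝ F] [NormedSpace ℂ F] [SMulCommClass ℝ ℂ F] [NormedAddCommGroup G]
    [NormedSpace ℝ G] [NormedSpace ℂ G] [SMulCommClass ℝ ℂ G] {Φ : 𝓢(X, G) → ℝ}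
    (h : SBdd Φ) (T : 𝓢(X, F) →L[ℂ] 𝓢(X, G)) : SBdd fun f => Φ (T f) := by
  obtain ⟨s, C, hC, h⟩ := h
  let q : Seminorm ℂ 𝓢(X, F) := (s.sup (schwartzSeminormFamily ℂ X G)).comp T.toLinearMap
  have hq : Continuous q := by
    have h1 : Continuous (fun f => (s.sup (schwartzSeminormFamily ℂ X G)) f) := by
      clear q h
      induction s using Finset.induction_on with
      | empty => simpa using continuous_const
      | insert a s ha ih =>
        simp only [Finset.sup_insert, Seminorm.sup_apply]
        exact ((schwartz_withSeminorms ℂ X G).continuous_seminorm a).max ih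
    exact h1.comp T.continuous
  obtain ⟨t, D, -, hD⟩ := Seminorm.bound_of_continuous (schwartz_withSeminorms ℂ X F) q hq
  refine ⟨t, C * D, by positivity, fun f => (h (T f)).trans ?_⟩
  rw [mul_assoc]
  refine mul_le_mul_of_nonneg_left ?_ hC
  exact hD f

lemma pft_sBdd (k n : ℕ) : ∀ {F : Type} [NormedAddCommGroup F] [NormedSpace ℝ F]
    [NormedSpace ℂ F] [IsScalarTower ℝ ℂ F] [SMulCommClass ℝ ℂ F],
    ∃ (s : Finset (ℕ × ℕ)) (C : ℝ), 0 ≤ C ∧ ∀ (f : 𝓢(V × E, F)) (z : V × E),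
      ‖z‖ ^ k * ‖iteratedFDeriv ℝ n (pft f) z‖ ≤ C * s.sup (schwartzSeminormFamily ℂ (V × E) F) f := by
  induction n with
  | zero =>
    intro F _ _ _ _ _
    have h1 : SBdd fun f : 𝓢(V × E, F) => decayInt E * cst f k 0 :=
      (sBdd_cst k 0).const_mul decayInt_nonneg
    have h2 : SBdd fun f : 𝓢(V × E, F) => (2 * Real.pi) ^ k * (2 ^ k *
        ∑ n ∈ Finset.range (k + 1), decayInt E * cst f 0 n) :=
      ((SBdd.sum (fun n => (sBdd_cst 0 n).const_mul decayInt_nonneg) _).const_mul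
        (by positivity)).const_mul (by positivity)
    obtain ⟨s, C, hC, h⟩ := h1.add h2
    refine ⟨s, C, hC, fun f z => le_trans ?_ (h f)⟩
    have a1 := fst_bound f k z
    have a2 := snd_bound f k z
    simp only [mul_comm _ (decayInt E)] at a1 a2
    rw [norm_iteratedFDeriv_zero]
    refine le_trans ?_ (add_le_add a1 a2)
    rw [← add_mul]
    gcongr
    rcases max_choice ‖z.1‖ ‖z.2‖ with hz | hz
    · rw [Prod.norm_def, hz]; exact le_add_of_nonneg_right (by positivity)
    · rw [Prod.norm_def, hz]; exact le_add_of_nonneg_left (by positivity)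
  | succ n ih =>
    intro F _ _ _ _ _
    obtain ⟨s, C, hC, h⟩ := ih (F := V × E →L[ℝ] F)
    obtain ⟨t, D, hD, h'⟩ := SBdd.comp (Φ := fun f => C * s.sup
      (schwartzSeminormFamily ℂ (V × E) (V × E →L[ℝ] F)) f) ⟨s, C, hC, fun _ => le_rfl⟩
      (pftDeriv V E F)
    refine ⟨t, D, hD, fun f z => le_trans ?_ (h' f)⟩
    have : fderiv ℝ (pft f) = pft (pftDeriv V E F f) := by
      ext1 z; exact (hasFDerivAt_pft f z).fderiv
    rw [← norm_iteratedFDeriv_fderiv, this]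
    exact h _ z

end Partial

/-! ### Operators on Schwartz spaces -/

/-- Configuration space `ℝⁿ`. -/
abbrev Rn (n : ℕ) : Type := EuclideanSpace ℝ (Fin n)

/-- The space `ℝⁿ × ℝⁿ`. -/
abbrev Ph (n : ℕ) : Type := Rn n × Rn n

instance (n : ℕ) : (volume : Measure (Ph n)).IsAddHaarMeasure :=
  inferInstanceAs ((volume : Measure (Rn n)).prod (volume : Measure (Rn n))).IsAddHaarMeasure

/-- The factor `(2π)^(-n/2)`. -/
def normC (n : ℕ) : ℂ := (((2 * Real.pi) ^ (-(n : ℝ) / 2) : ℝ) : ℂ)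

section Ops
variable {V A B : Type} [NormedAddCommGroup V] [NormedSpace ℝ V]
  [NormedAddCommGroup A] [NormedSpace ℝ A] [NormedAddCommGroup B] [NormedSpace ℝ B] {n : ℕ}

/-- The partial Fourier integral, without normalisation, on Schwartz space. -/
def pftS (V : Type) [NormedAddCommGroup V] [NormedSpace ℝ V] (n : ℕ) :
    𝓢(V × Rn n, ℂ) →L[ℂ] 𝓢(V × Rn n, ℂ) :=
  SchwartzMap.mkCLM (σ := RingHom.id ℂ) (fun f => pft f)
    (fun f g z => by
      simp only [pft, add_apply, smul_add]
      exact integral_add (slice_integrable f z) (slice_integrable g z))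
    (fun c f z => by
      simp only [pft, smul_apply, smul_comm _ c]
      exact integral_smul c _)
    contDiff_pft (fun m => pft_sBdd m.1 m.2)

/-- Composition of a Schwartz function with a linear isomorphism. -/
abbrev compLin (L : A ≃L[ℝ] B) : 𝓢(B, ℂ) →L[ℂ] 𝓢(A, ℂ) :=
  SchwartzMap.compCLMOfContinuousLinearEquiv ℂ L

/-- The partial Fourier transform `Ψ(v, p) ↦ (2π)^(-n/2) ∫ e^(-i p·ξ) Ψ(v, p) dp`. -/
def partialFourier (V : Type) [NormedAddCommGroup V] [NormedSpace ℝ V] (n : ℕ) :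
    𝓢(V × Rn n, ℂ) →L[ℂ] 𝓢(V × Rn n, ℂ) :=
  normC n • pftS V n

theorem partialFourier_apply (f : 𝓢(V × Rn n, ℂ)) (v : V) (ξ : Rn n) :
    partialFourier V n f (v, ξ) =
      normC n * ∫ p : Rn n, Complex.exp (-(⟪p, ξ⟫ : ℝ) * Complex.I) * f (v, p) := by
  change normC n • pft f (v, ξ) = _
  simp [pft]

/-- The inverse partial Fourier transform `Φ(v, ξ) ↦ (2π)^(-n/2) ∫ e^(i ξ·p) Φ(v, ξ) dξ`. -/
def partialFourierInv (V : Type) [NormedAddCommGroup V] [NormedSpace ℝ V] (n : ℕ) :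
    𝓢(V × Rn n, ℂ) →L[ℂ] 𝓢(V × Rn n, ℂ) :=
  (compLin ((ContinuousLinearEquiv.refl ℝ V).prodCongr (ContinuousLinearEquiv.neg ℝ))).comp
    (partialFourier V n)

theorem partialFourierInv_apply (f : 𝓢(V × Rn n, ℂ)) (v : V) (p : Rn n) :
    partialFourierInv V n f (v, p) =
      normC n * ∫ ξ : Rn n, Complex.exp ((⟪ξ, p⟫ : ℝ) * Complex.I) * f (v, ξ) := by
  change partialFourier V n f (v, -p) = _
  rw [partialFourier_apply]
  simp

/-- The inclusion `v ↦ (v, 0)` is an isometric embedding. -/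
theorem antilipschitz_inl :
    AntilipschitzWith 1 (ContinuousLinearMap.inl ℝ V (Rn n)) :=
  AddMonoidHomClass.antilipschitz_of_bound _ fun x => by simp [Prod.norm_def]

/-- Integration over the second variable, `Ψ(v, p) ↦ ∫ Ψ(v, p) dp`. -/
def integrateSnd (V : Type) [NormedAddCommGroup V] [NormedSpace ℝ V] (n : ℕ) :
    𝓢(V × Rn n, ℂ) →L[ℂ] 𝓢(V, ℂ) :=
  (SchwartzMap.compCLMOfAntilipschitz ℂ
    (ContinuousLinearMap.inl ℝ V (Rn n)).hasTemperateGrowth antilipschitz_inl).comp (pftS V n)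

theorem integrateSnd_apply (f : 𝓢(V × Rn n, ℂ)) (v : V) :
    integrateSnd V n f v = ∫ p : Rn n, f (v, p) := by
  change pft f (v, 0) = _
  simp [pft]

theorem norm_iteratedFDeriv_comp_fst_le (f : 𝓢(A, ℂ)) (i : ℕ) (z : A × B) :
    ‖iteratedFDeriv ℝ i (fun z : A × B => f z.1) z‖ ≤ ‖iteratedFDeriv ℝ i f z.1‖ := by
  have h := (ContinuousLinearMap.fst ℝ A B).iteratedFDeriv_comp_right (f.smooth i) z le_rfl
  change ‖iteratedFDeriv ℝ i (f ∘ ContinuousLinearMap.fst ℝ A B) z‖ ≤ _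
  rw [h]
  refine (ContinuousMultilinearMap.norm_compContinuousLinearMap_le _ _).trans ?_
  exact mul_le_of_le_one_right (norm_nonneg _) (Finset.prod_le_one (by simp) fun _ _ =>
    ContinuousLinearMap.norm_fst_le ..)

theorem norm_iteratedFDeriv_comp_snd_le (f : 𝓢(B, ℂ)) (i : ℕ) (z : A × B) :
    ‖iteratedFDeriv ℝ i (fun z : A × B => f z.2) z‖ ≤ ‖iteratedFDeriv ℝ i f z.2‖ := by
  have h := (ContinuousLinearMap.snd ℝ A B).iteratedFDeriv_comp_right (f.smooth i) z le_rfl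
  change ‖iteratedFDeriv ℝ i (f ∘ ContinuousLinearMap.snd ℝ A B) z‖ ≤ _
  rw [h]
  refine (ContinuousMultilinearMap.norm_compContinuousLinearMap_le _ _).trans ?_
  exact mul_le_of_le_one_right (norm_nonneg _) (Finset.prod_le_one (by simp) fun _ _ =>
    ContinuousLinearMap.norm_snd_le ..)

/-- The tensor product `(f ⊗ g)(x, y) = f(x) g(y)`, as a function of `g`. -/
def tensorL (f : 𝓢(A, ℂ)) : 𝓢(B, ℂ) →L[ℂ] 𝓢(A × B, ℂ) :=
  SchwartzMap.mkCLM (σ := RingHom.id ℂ) (fun g z => f z.1 * g z.2)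
    (fun g h z => by simp [mul_add])
    (fun c g z => by simp; ring)
    (fun g => ((f.smooth ⊤).comp contDiff_fst).mul ((g.smooth ⊤).comp contDiff_snd))
    (fun m => by
      have hS : SBdd (fun g : 𝓢(B, ℂ) => ∑ i ∈ Finset.range (m.2 + 1), (m.2.choose i : ℝ) *
          (SchwartzMap.seminorm ℂ m.1 i f * SchwartzMap.seminorm ℂ 0 (m.2 - i) g +
            SchwartzMap.seminorm ℂ 0 i f * SchwartzMap.seminorm ℂ m.1 (m.2 - i) g)) := by
        refine SBdd.sum (fun i => SBdd.const_mul (SBdd.add (SBdd.const_mul ?_ (by positivity))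
          (SBdd.const_mul ?_ (by positivity))) (by positivity)) _
        · exact ⟨{(0, m.2 - i)}, 1, zero_le_one, fun g => by simp⟩
        · exact ⟨{(m.1, m.2 - i)}, 1, zero_le_one, fun g => by simp⟩
      obtain ⟨s, C, hC, h⟩ := hS
      refine ⟨s, C, hC, fun g z => le_trans ?_ (h g)⟩
      have h1 := norm_iteratedFDeriv_mul_le (n := m.2) (N := ∞)
        ((f.smooth ⊤).comp (contDiff_fst (E := A) (F := B)))
        ((g.smooth ⊤).comp (contDiff_snd (E := A) (F := B))) z (mod_cast le_top)
      refine (mul_le_mul_of_nonneg_left h1 (by positivity)).trans ?_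
      rw [Finset.mul_sum]
      refine Finset.sum_le_sum fun i _ => ?_
      have h2 := norm_iteratedFDeriv_comp_fst_le f i z
      have h3 := norm_iteratedFDeriv_comp_snd_le g (m.2 - i) z
      have hz : ‖z‖ ^ m.1 ≤ ‖z.1‖ ^ m.1 + ‖z.2‖ ^ m.1 := by
        rcases max_choice ‖z.1‖ ‖z.2‖ with hz | hz
        · rw [Prod.norm_def, hz]; exact le_add_of_nonneg_right (by positivity)
        · rw [Prod.norm_def, hz]; exact le_add_of_nonneg_left (by positivity)
      have f1 := f.le_seminorm ℂ m.1 i z.1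
      have f2 := f.le_seminorm ℂ 0 i z.1
      have g1 := g.le_seminorm ℂ m.1 (m.2 - i) z.2
      have g2 := g.le_seminorm ℂ 0 (m.2 - i) z.2
      rw [pow_zero, one_mul] at f2 g2
      calc ‖z‖ ^ m.1 * (m.2.choose i * ‖iteratedFDeriv ℝ i (fun z : A × B => f z.1) z‖ *
            ‖iteratedFDeriv ℝ (m.2 - i) (fun z : A × B => g z.2) z‖)
          ≤ (‖z.1‖ ^ m.1 + ‖z.2‖ ^ m.1) * (m.2.choose i * ‖iteratedFDeriv ℝ i f z.1‖ *
            ‖iteratedFDeriv ℝ (m.2 - i) g z.2‖) := by gcongr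
        _ = m.2.choose i * ((‖z.1‖ ^ m.1 * ‖iteratedFDeriv ℝ i f z.1‖) *
              ‖iteratedFDeriv ℝ (m.2 - i) g z.2‖ + ‖iteratedFDeriv ℝ i f z.1‖ *
              (‖z.2‖ ^ m.1 * ‖iteratedFDeriv ℝ (m.2 - i) g z.2‖)) := by ring
        _ ≤ _ := by gcongr)

@[simp] theorem tensorL_apply (f : 𝓢(A, ℂ)) (g : 𝓢(B, ℂ)) (z : A × B) :
    tensorL f g z = f z.1 * g z.2 := rfl

theorem tensorL_add (f f' : 𝓢(A, ℂ)) : tensorL (B := B) (f + f') = tensorL f + tensorL f' := by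
  ext g z; simp [add_mul]

theorem tensorL_smul (c : ℂ) (f : 𝓢(A, ℂ)) : tensorL (B := B) (c • f) = c • tensorL f := by
  ext g z; simp [mul_assoc]

/-- The tensor product `(f ⊗ g)(x, y) = f(x) g(y)`, as a function of `f`. -/
def tensorR (g : 𝓢(B, ℂ)) : 𝓢(A, ℂ) →L[ℂ] 𝓢(A × B, ℂ) :=
  (compLin (ContinuousLinearEquiv.prodComm ℝ A B)).comp (tensorL g)

theorem tensorR_apply (f : 𝓢(A, ℂ)) (g : 𝓢(B, ℂ)) (z : A × B) :
    tensorR g f z = f z.1 * g z.2 := mul_comm _ _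

/-- The complex conjugate of a Schwartz function. -/
def conjS (f : 𝓢(A, ℂ)) : 𝓢(A, ℂ) :=
  SchwartzMap.postcompCLM (𝕜 := ℝ) Complex.conjCLE.toContinuousLinearMap f

@[simp] theorem conjS_apply (f : 𝓢(A, ℂ)) (x : A) : conjS f x = (starRingEnd ℂ) (f x) := rfl

/-- `Ψ(x, p) ↦ ∫ g(p) Ψ(x, p) dp`. -/
def contractSnd (g : 𝓢(Rn n, ℂ)) : 𝓢(V × Rn n, ℂ) →L[ℂ] 𝓢(V, ℂ) :=
  (integrateSnd V n).comp (SchwartzMap.smulLeftCLM ℂ fun z : V × Rn n => g z.2)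

theorem contractSnd_apply (g : 𝓢(Rn n, ℂ)) (f : 𝓢(V × Rn n, ℂ)) (v : V) :
    contractSnd g f v = ∫ p : Rn n, g p * f (v, p) := by
  have hg : Function.HasTemperateGrowth fun z : V × Rn n => g z.2 :=
    g.hasTemperateGrowth.comp (ContinuousLinearMap.snd ℝ V (Rn n)).hasTemperateGrowth
  simp [contractSnd, integrateSnd_apply, SchwartzMap.smulLeftCLM_apply hg]

end Ops

/-- The unitary Fourier transform `φ(y) ↦ (2π)^(-n/2) ∫ e^(-i y·p) φ(y) dy`. -/
def fourierS {n : ℕ} (φ : 𝓢(Rn n, ℂ)) : 𝓢(Rn n, ℂ) :=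
  normC n • compLin (ContinuousLinearEquiv.smulLeft
    (Units.mk0 ((2 * Real.pi)⁻¹ : ℝ) (by positivity))) (𝓕 φ)

theorem fourierS_apply {n : ℕ} (φ : 𝓢(Rn n, ℂ)) (p : Rn n) :
    fourierS φ p = normC n * ∫ y : Rn n, Complex.exp (-(⟪y, p⟫ : ℝ) * Complex.I) * φ y := by
  have h := pft_eq_fourier (fun z : Rn n × Rn n => φ z.2) (0, p)
  simp only [pft, smul_eq_mul, Complex.ofReal_neg] at h
  rw [h]
  rfl

/-! ### The metaplectic group `Û(θ)` -/

section Metaplectic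
variable {n : ℕ}

/-- The flow `(x, ξ) ↦ (x(θ), ξ(θ))` of the elliptic rotation, as a map. -/
def rotFun (n : ℕ) (θ : ℝ) (z : Ph n) : Ph n :=
  ((Real.cos (√7 * θ) - Real.sin (√7 * θ) / √7) • z.1 + (2 * Real.sin (√7 * θ) / √7) • z.2,
    (Real.cos (√7 * θ) + Real.sin (√7 * θ) / √7) • z.2 - (4 * Real.sin (√7 * θ) / √7) • z.1)

theorem rotFun_neg (θ : ℝ) (z : Ph n) : rotFun n (-θ) (rotFun n θ z) = z := by
  have h7 : (√7 : ℝ) ≠ 0 := by positivity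
  have h7' : (√7 : ℝ) ^ 2 = 7 := Real.sq_sqrt (by norm_num)
  have hcs := Real.sin_sq_add_cos_sq (√7 * θ)
  have key : (Real.cos (√7 * θ) + Real.sin (√7 * θ) / √7) *
      (Real.cos (√7 * θ) - Real.sin (√7 * θ) / √7) +
      (2 * Real.sin (√7 * θ) / √7) * (4 * Real.sin (√7 * θ) / √7) = 1 := by
    field_simp
    rw [h7']
    nlinarith
  simp only [rotFun, mul_neg, Real.cos_neg, Real.sin_neg]
  refine Prod.ext ?_ ?_
  · ext i
    simp
    linear_combination key * z.1 i
  · ext i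
    simp
    linear_combination key * z.2 i

/-- The flow `(x, ξ) ↦ (x(θ), ξ(θ))` of the elliptic rotation. -/
def rot (n : ℕ) (θ : ℝ) : Ph n ≃L[ℝ] Ph n where
  toFun := rotFun n θ
  invFun := rotFun n (-θ)
  map_add' z w := by ext <;> simp [rotFun] <;> ring
  map_smul' c z := by ext <;> simp [rotFun] <;> ring
  left_inv := rotFun_neg θ
  right_inv z := by simpa using rotFun_neg (-θ) z
  continuous_toFun := by unfold rotFun; fun_prop
  continuous_invFun := by unfold rotFun; fun_prop

/-- The unitary group `Û(θ) = F⁻¹ T(θ) F` on Schwartz space, where `F` is the partial Fourier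
transform in the second variable and `T(θ)Φ(x, ξ) = Φ(x(-θ), ξ(-θ))`. Its inverse is `Û(-θ)`. -/
def metaU (n : ℕ) (θ : ℝ) : 𝓢(Ph n, ℂ) →L[ℂ] 𝓢(Ph n, ℂ) :=
  (partialFourierInv (Rn n) n).comp ((compLin (rot n (-θ))).comp (partialFourier (Rn n) n))

/-- `Û(θ) = F⁻¹ T(θ) F` on tempered distributions, each factor being extended by duality:
`⟨F u, Ξ⟩ = ⟨u, F Ξ⟩`, `⟨F⁻¹ u, Ξ⟩ = ⟨u, F⁻¹ Ξ⟩`, and `⟨T(θ) u, Ξ⟩ = ⟨u, T(-θ) Ξ⟩` because the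
rotation has determinant one. -/
def metaUD (n : ℕ) (θ : ℝ) : 𝓢'(Ph n, ℂ) →L[ℂ] 𝓢'(Ph n, ℂ) :=
  (PointwiseConvergenceCLM.precomp ℂ (partialFourierInv (Rn n) n)).comp
    ((PointwiseConvergenceCLM.precomp ℂ (compLin (rot n θ))).comp
      (PointwiseConvergenceCLM.precomp ℂ (partialFourier (Rn n) n)))

/-- The angle `θ₀ = (√7/7) arccos(3/4)`; the metaplectic operator `Ŝ` is `Û(θ₀)`. -/
def theta0 : ℝ := √7 / 7 * Real.arccos (3 / 4)

end Metaplectic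

/-! ### Weyl operators and Bopp operators -/

section Weyl
variable {n : ℕ}

/-- The change of variables `(x, y) ↦ (x - y/2, x + y/2)`. -/
def midMap (n : ℕ) : Ph n ≃L[ℝ] Ph n where
  toFun z := (z.1 - (1 / 2 : ℝ) • z.2, z.1 + (1 / 2 : ℝ) • z.2)
  invFun w := ((1 / 2 : ℝ) • (w.1 + w.2), w.2 - w.1)
  map_add' z w := by ext <;> simp <;> ring
  map_smul' c z := by ext <;> simp <;> ring
  left_inv z := by ext <;> simp <;> ring
  right_inv z := by ext <;> simp <;> ring
  continuous_toFun := by fun_prop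
  continuous_invFun := by fun_prop

/-- `G ↦ ((x, p) ↦ (2π)^(-n) ∫ e^(i y·p) G(x - y/2, x + y/2) dy)`. -/
def wignerKernel (n : ℕ) : 𝓢(Ph n, ℂ) →L[ℂ] 𝓢(Ph n, ℂ) :=
  normC n • (partialFourierInv (Rn n) n).comp (compLin (midMap n))

theorem wignerKernel_apply (G : 𝓢(Ph n, ℂ)) (x p : Rn n) :
    wignerKernel n G (x, p) = ((2 * Real.pi : ℂ) ^ n)⁻¹ *
      ∫ y : Rn n, Complex.exp ((⟪y, p⟫ : ℝ) * Complex.I) *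
        G (x - (1 / 2 : ℝ) • y, x + (1 / 2 : ℝ) • y) := by
  have hc : normC n * normC n = ((2 * Real.pi) ^ n : ℂ)⁻¹ := by
    rw [normC, ← Complex.ofReal_mul, ← Real.rpow_add (by positivity), ← add_div, ← two_mul,
      mul_div_cancel_left₀ _ two_ne_zero, Real.rpow_neg (by positivity), Real.rpow_natCast]
    push_cast
    rfl
  change normC n • partialFourierInv (Rn n) n _ (x, p) = _
  rw [partialFourierInv_apply, smul_eq_mul, ← mul_assoc, hc]
  rfl

/-- The Weyl operator with symbol `a`,
`â ψ(x) = (2π)^(-n) ∫∫ e^(i (x - x')·k) a((x + x')/2, k) ψ(x') dx' dk`, understood in the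
distributional sense: testing with `ξ(x)` and substituting `x' = X - y/2`, `x = X + y/2`, one has
`⟨â ψ, ξ⟩ = ⟨a, (X, k) ↦ (2π)^(-n) ∫ e^(i y·k) ψ(X - y/2) ξ(X + y/2) dy⟩`. -/
def weylOp (a : 𝓢'(Ph n, ℂ)) : 𝓢(Rn n, ℂ) →ₗ[ℂ] 𝓢'(Rn n, ℂ) where
  toFun ψ := PointwiseConvergenceCLM.precomp ℂ ((wignerKernel n).comp (tensorL ψ)) a
  map_add' ψ ψ' := by
    ext ξ
    change a (wignerKernel n (tensorL (ψ + ψ') ξ)) =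
      a (wignerKernel n (tensorL ψ ξ)) + a (wignerKernel n (tensorL ψ' ξ))
    simp [tensorL_add]
  map_smul' c ψ := by
    ext ξ
    change a (wignerKernel n (tensorL (c • ψ) ξ)) = c * a (wignerKernel n (tensorL ψ ξ))
    simp [tensorL_smul]

/-- The embedding `((x', x), p) ↦ ((x', p), (x, p))`. -/
def diagMap (n : ℕ) : Ph n × Rn n →L[ℝ] Ph n × Ph n :=
  (((ContinuousLinearMap.fst ℝ (Rn n) (Rn n)).comp (ContinuousLinearMap.fst ℝ (Ph n) (Rn n))).prod
    (ContinuousLinearMap.snd ℝ (Ph n) (Rn n))).prod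
  (((ContinuousLinearMap.snd ℝ (Rn n) (Rn n)).comp (ContinuousLinearMap.fst ℝ (Ph n) (Rn n))).prod
    (ContinuousLinearMap.snd ℝ (Ph n) (Rn n)))

theorem antilipschitz_diagMap : AntilipschitzWith 1 (diagMap n) :=
  AddMonoidHomClass.antilipschitz_of_bound _ fun z => by
    simp only [diagMap, Prod.norm_def, NNReal.coe_one, one_mul]
    refine max_le (max_le ?_ ?_) ?_
    · exact le_max_of_le_left (le_max_left _ _)
    · exact le_max_of_le_right (le_max_left _ _)
    · exact le_max_of_le_right (le_max_right _ _)

/-- `Ξ ↦ ((x', x) ↦ ∫ Ψ(x', p) Ξ(x, p) dp)`. -/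
def contractPhase (Ψ : 𝓢(Ph n, ℂ)) : 𝓢(Ph n, ℂ) →L[ℂ] 𝓢(Ph n, ℂ) :=
  (integrateSnd (Ph n) n).comp ((SchwartzMap.compCLMOfAntilipschitz ℂ
    (diagMap n).hasTemperateGrowth antilipschitz_diagMap).comp (tensorL Ψ))

theorem contractPhase_apply (Ψ Ξ : 𝓢(Ph n, ℂ)) (x' x : Rn n) :
    contractPhase Ψ Ξ (x', x) = ∫ p : Rn n, Ψ (x', p) * Ξ (x, p) := by
  simp only [contractPhase, ContinuousLinearMap.comp_apply, integrateSnd_apply]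
  rfl

/-- The extension of the Weyl operator to phase space functions,
`Â Ψ(x, p) = (2π)^(-n) ∫∫ e^(i (x - x')·k) a((x + x')/2, k) Ψ(x', p) dx' dk`, understood in the
distributional sense. -/
def phaseOp (a : 𝓢'(Ph n, ℂ)) : 𝓢(Ph n, ℂ) →ₗ[ℂ] 𝓢'(Ph n, ℂ) where
  toFun Ψ := PointwiseConvergenceCLM.precomp ℂ ((wignerKernel n).comp (contractPhase Ψ)) a
  map_add' Ψ Ψ' := by
    ext Ξ
    change a (wignerKernel n (contractPhase (Ψ + Ψ') Ξ)) =
      a (wignerKernel n (contractPhase Ψ Ξ)) + a (wignerKernel n (contractPhase Ψ' Ξ))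
    simp [contractPhase, tensorL_add]
  map_smul' c Ψ := by
    ext Ξ
    change a (wignerKernel n (contractPhase (c • Ψ) Ξ)) =
      c * a (wignerKernel n (contractPhase Ψ Ξ))
    simp [contractPhase, tensorL_smul]

/-- The Bopp operator `Â_B = Ŝ Â Ŝ⁻¹`, where `Ŝ = Û(θ₀)`. -/
def boppOp (a : 𝓢'(Ph n, ℂ)) : 𝓢(Ph n, ℂ) →ₗ[ℂ] 𝓢'(Ph n, ℂ) :=
  (metaUD n theta0).toLinearMap ∘ₗ phaseOp a ∘ₗ (metaU n (-theta0)).toLinearMap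

end Weyl

/-! ### The windowed Wigner transform and its adjoint -/

section Wigner
variable {n : ℕ}

/-- The cross Wigner function
`W(ψ, φ)(x, p) = (2π)^(-n) ∫ e^(i p·y) ψ(x - y/2) conj(φ(x + y/2)) dy`. -/
def crossWigner (ψ φ : 𝓢(Rn n, ℂ)) : 𝓢(Ph n, ℂ) := wignerKernel n (tensorL ψ (conjS φ))

theorem crossWigner_apply (ψ φ : 𝓢(Rn n, ℂ)) (x p : Rn n) :
    crossWigner ψ φ (x, p) = ((2 * Real.pi : ℂ) ^ n)⁻¹ *
      ∫ y : Rn n, Complex.exp ((⟪y, p⟫ : ℝ) * Complex.I) *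
        (ψ (x - (1 / 2 : ℝ) • y) * (starRingEnd ℂ) (φ (x + (1 / 2 : ℝ) • y))) := by
  rw [crossWigner, wignerKernel_apply]
  simp

/-- The windowed Wigner transform `W_φ ψ = (2π)^(n/2) W(ψ, φ)` on Schwartz functions. -/
def windWigner (φ : 𝓢(Rn n, ℂ)) : 𝓢(Rn n, ℂ) →ₗ[ℂ] 𝓢(Ph n, ℂ) where
  toFun ψ := (((2 * Real.pi) ^ ((n : ℝ) / 2) : ℝ) : ℂ) • crossWigner ψ φ
  map_add' ψ ψ' := by simp [crossWigner, tensorL_add]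
  map_smul' c ψ := by
    simp only [crossWigner, tensorL_smul, smul_apply, map_smul,
      RingHom.id_apply]
    exact smul_comm _ _ _

/-- The windowed Wigner transform on tempered distributions, `W_φ u = Ŝ (u ⊗ conj φ̂)`. -/
def windWignerD (φ : 𝓢(Rn n, ℂ)) : 𝓢'(Rn n, ℂ) →L[ℂ] 𝓢'(Ph n, ℂ) :=
  (metaUD n theta0).comp (PointwiseConvergenceCLM.precomp ℂ (contractSnd (conjS (fourierS φ))))

/-- The adjoint of the windowed Wigner transform on Schwartz functions,
`W_φ^* Ψ(x) = ∫ φ̂(p) (Ŝ⁻¹ Ψ)(x, p) dp`. -/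
def windWignerAdj (φ : 𝓢(Rn n, ℂ)) : 𝓢(Ph n, ℂ) →L[ℂ] 𝓢(Rn n, ℂ) :=
  (contractSnd (fourierS φ)).comp (metaU n (-theta0))

/-- The adjoint of the windowed Wigner transform on tempered distributions,
`⟨W_φ^* u, ξ⟩ = ⟨Ŝ⁻¹ u, ξ ⊗ φ̂⟩`. -/
def windWignerAdjD (φ : 𝓢(Rn n, ℂ)) : 𝓢'(Ph n, ℂ) →L[ℂ] 𝓢'(Rn n, ℂ) :=
  (PointwiseConvergenceCLM.precomp ℂ (tensorR (fourierS φ))).comp (metaUD n (-theta0))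

end Wigner

/-! ### Eigenfunctions and the Schrödinger equation -/

section Spectral
variable {V : Type} [NormedAddCommGroup V] [NormedSpace ℝ V] [MeasureSpace V] [BorelSpace V]
  [SecondCountableTopology V] [(volume : Measure V).HasTemperateGrowth]

/-- The tempered distribution given by a Schwartz function. -/
abbrev toD (f : 𝓢(V, ℂ)) : 𝓢'(V, ℂ) := SchwartzMap.toTemperedDistributionCLM V ℂ volume f

/-- `f` is an eigenfunction of `T`, with eigenvalue `μ`. -/
def IsEigenfunction (T : 𝓢(V, ℂ) →ₗ[ℂ] 𝓢'(V, ℂ)) (μ : ℂ) (f : 𝓢(V, ℂ)) : Prop :=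
  f ≠ 0 ∧ T f = μ • toD f

/-- `μ` is an eigenvalue of `T`. -/
def IsEigenvalue (T : 𝓢(V, ℂ) →ₗ[ℂ] 𝓢'(V, ℂ)) (μ : ℂ) : Prop :=
  ∃ f, IsEigenfunction T μ f

/-- `u` solves `i ∂u/∂t = T u`, `u(0) = u₀` for times in `J`, the derivative being taken in the
space of tempered distributions. -/
def IsSolution (T : 𝓢(V, ℂ) →ₗ[ℂ] 𝓢'(V, ℂ)) (J : Set ℝ) (u₀ : 𝓢(V, ℂ)) (u : ℝ → 𝓢(V, ℂ)) :
    Prop :=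
  u 0 = u₀ ∧ ∀ t ∈ J, ∀ ξ : 𝓢(V, ℂ),
    HasDerivWithinAt (fun s => Complex.I * toD (u s) ξ) (T (u t) ξ) J t

/-- `u` is the solution, and the only one, of the initial value problem. -/
def IsUniqueSolution (T : 𝓢(V, ℂ) →ₗ[ℂ] 𝓢'(V, ℂ)) (J : Set ℝ) (u₀ : 𝓢(V, ℂ))
    (u : ℝ → 𝓢(V, ℂ)) : Prop :=
  IsSolution T J u₀ u ∧ ∀ v, IsSolution T J u₀ v → Set.EqOn u v J

end Spectral

/-- A family of Schwartz functions that is an orthonormal basis of `L²`. -/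
def IsONBasis {V : Type} [NormedAddCommGroup V] [NormedSpace ℝ V] [MeasureSpace V] [BorelSpace V]
    [SecondCountableTopology V] [(volume : Measure V).HasTemperateGrowth] {ι : Type*}
    (e : ι → 𝓢(V, ℂ)) : Prop :=
  Orthonormal ℂ (fun i => (e i).toLp 2) ∧
    (Submodule.span ℂ (Set.range fun i => (e i).toLp 2)).topologicalClosure = ⊤

end Bopp

end

/-! Everything rests on the factorisation `W_φ ψ = Ŝ(ψ ⊗ conj φ̂)` (`windWigner_eq`). At the angle
`θ₀` the rotation inside `Ŝ` is `(x, ξ) ↦ (x - ξ/2, x + ξ/2)`, so `F⁻¹ T(θ₀) F` performs exactly the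
midpoint substitution and the Fourier integral of the Wigner transform.

The operator `Â` acts on `x` alone: `Â(ψ ⊗ h) = âψ ⊗ h`, and integrating `ÂΨ` against `φ̂` in `p`
gives `â` of the integrated `Ψ`. Conjugation by `Ŝ` turns these two facts into the intertwining
relations. The midpoint map preserves volume and the partial Fourier transform is unitary, so `Ŝ` is
unitary and is compatible with its extension to distributions; this yields the adjoint relation,
Moyal's identity and `W_φ^* W_φ = 1`.

Eigenfunctions and solutions are then simply transported. A single `W_φ^*` may kill a given nonzero
`Ψ`, but some window does not: take `φ̂` proportional to the conjugate of a nonzero slice of `Ŝ⁻¹Ψ`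
(`exists_windWignerAdj_ne_zero`). This gives the passage of eigenvalues from `Â_B` to `â` and of
uniqueness from `â` to `Â_B`; the opposite passages need only that `W_φ` is injective.

For bases, orthonormality is Moyal's identity. Completeness is preserved by the unitary `Ŝ` and by
the antiunitary `φ ↦ conj φ̂`, so it reduces to the completeness of tensor products, which is
Fubini's theorem. -/

noncomputable section
namespace Bopp

/-! ### Fourier inversion, fibre by fibre, and complex conjugation -/

section Inversion
variable {V : Type} [NormedAddCommGroup V] [NormedSpace ℝ V] {n : ℕ}

/-- The restriction `p ↦ f(v, p)` of a Schwartz function. -/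
def slice (f : 𝓢(V × Rn n, ℂ)) (v : V) : 𝓢(Rn n, ℂ) :=
  SchwartzMap.compCLMOfAntilipschitz (K := 1) ℂ (g := fun p : Rn n => (v, p))
    (by
      have h : (fun p : Rn n => (v, p)) =
          (fun _ => ((v, 0) : V × Rn n)) + fun p => ContinuousLinearMap.inr ℝ V (Rn n) p := by
        ext p <;> simp
      rw [h]
      exact (Function.HasTemperateGrowth.const _).add
        (ContinuousLinearMap.inr ℝ V (Rn n)).hasTemperateGrowth)
    (AntilipschitzWith.of_le_mul_dist fun p q => by simp [Prod.dist_eq]) f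

@[simp] theorem slice_apply (f : 𝓢(V × Rn n, ℂ)) (v : V) (p : Rn n) : slice f v p = f (v, p) := rfl

theorem partialFourier_eq_fourierS (f : 𝓢(V × Rn n, ℂ)) (v : V) (ξ : Rn n) :
    partialFourier V n f (v, ξ) = fourierS (slice f v) ξ := by
  rw [partialFourier_apply, fourierS_apply]; rfl

theorem normC_mul_self (n : ℕ) : normC n * normC n = ((2 * Real.pi) ^ n : ℂ)⁻¹ := by
  rw [normC, ← Complex.ofReal_mul, ← Real.rpow_add (by positivity), ← add_div, ← two_mul,
    mul_div_cancel_left₀ _ two_ne_zero, Real.rpow_neg (by positivity), Real.rpow_natCast]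
  push_cast
  rfl

theorem conj_normC (n : ℕ) : (starRingEnd ℂ) (normC n) = normC n := Complex.conj_ofReal _

/-- This is the inversion formula for `𝓕`, whose exponent carries `2π`, after rescaling the
frequency; the Jacobian `(2π)^n` cancels the square of `normC n`. -/
theorem fourierS_inversion (f : 𝓢(Rn n, ℂ)) (y : Rn n) :
    fourierS (fourierS f) (-y) = f y := by
  have hpi : (2 * Real.pi) ≠ 0 := by positivity
  have h1 : ∫ p : Rn n, Complex.exp (-(⟪p, -y⟫ : ℝ) * Complex.I) * fourierS f p =
      normC n * ((2 * Real.pi) ^ n * f y) := by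
    have h2 : (𝓕⁻ (𝓕 f)) y = f y := by rw [FourierTransform.fourierInv_fourier_eq]
    have h3 : (𝓕⁻ (𝓕 f)) y =
        ∫ q : Rn n, Complex.exp (((2 * Real.pi * ⟪q, y⟫ : ℝ) : ℂ) * Complex.I) • (𝓕 f) q := by
      rw [fourierInv_coe, Real.fourierInv_eq']
    -- The substitution `p = 2πq`.
    have h4 := Measure.integral_comp_inv_smul (volume : Measure (Rn n))
      (fun q => Complex.exp (((2 * Real.pi * ⟪q, y⟫ : ℝ) : ℂ) * Complex.I) • (𝓕 f) q) (2 * Real.pi)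
    rw [← h3, h2] at h4
    have h5 : ∀ p : Rn n, Complex.exp (-(⟪p, -y⟫ : ℝ) * Complex.I) * fourierS f p =
        normC n * (Complex.exp (((2 * Real.pi * ⟪(2 * Real.pi)⁻¹ • p, y⟫ : ℝ) : ℂ) * Complex.I) •
          (𝓕 f) ((2 * Real.pi)⁻¹ • p)) := by
      intro p
      rw [real_inner_smul_left, mul_inv_cancel_left₀ hpi, inner_neg_right]
      change _ * (normC n * (𝓕 f) ((2 * Real.pi)⁻¹ • p)) = _
      simp only [smul_eq_mul]
      push_cast
      rw [neg_neg]
      ring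
    simp_rw [h5]
    rw [integral_const_mul, h4]
    simp [abs_of_pos Real.pi_pos]
  have hc : ((2 * Real.pi : ℂ) ^ n) ≠ 0 := by
    have : (2 * Real.pi : ℂ) ≠ 0 := mod_cast hpi
    positivity
  rw [fourierS_apply, h1, ← mul_assoc, normC_mul_self, inv_mul_cancel_left₀ hc]

theorem partialFourierInv_partialFourier (f : 𝓢(V × Rn n, ℂ)) :
    partialFourierInv V n (partialFourier V n f) = f := by
  ext ⟨v, p⟩
  change partialFourier V n (partialFourier V n f) (v, -p) = _
  have h : slice (partialFourier V n f) v = fourierS (slice f v) := by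
    ext ξ; exact partialFourier_eq_fourierS f v ξ
  rw [partialFourier_eq_fourierS, h, fourierS_inversion]
  rfl

/-- Reflection commutes with the transform, so the left inverse just found is also a right inverse.
-/
theorem partialFourier_comp_neg (f : 𝓢(V × Rn n, ℂ)) (v : V) (ξ : Rn n) :
    partialFourier V n (compLin ((ContinuousLinearEquiv.refl ℝ V).prodCongr
      (ContinuousLinearEquiv.neg ℝ)) f) (v, ξ) = partialFourier V n f (v, -ξ) := by
  rw [partialFourier_apply, partialFourier_apply, ← integral_neg_eq_self]
  congr 2
  ext p
  simp

theorem partialFourier_partialFourierInv (f : 𝓢(V × Rn n, ℂ)) :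
    partialFourier V n (partialFourierInv V n f) = f := by
  ext ⟨v, p⟩
  rw [partialFourierInv, ContinuousLinearMap.comp_apply, partialFourier_comp_neg]
  exact DFunLike.congr_fun (partialFourierInv_partialFourier f) (v, p)

theorem fourierS_conjS (φ : 𝓢(Rn n, ℂ)) (p : Rn n) :
    fourierS (conjS φ) p = (starRingEnd ℂ) (fourierS φ (-p)) := by
  rw [fourierS_apply, fourierS_apply, map_mul, conj_normC, ← integral_conj]
  congr 2
  ext y
  simp [← Complex.exp_conj]

/-- Conjugation exchanges the Fourier transform and its inverse. This identity turns the factor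
`conj φ̂` of the tensor product into the `conj φ` of the Wigner integral. -/
theorem fourierS_conjS_fourierS (φ : 𝓢(Rn n, ℂ)) : fourierS (conjS (fourierS φ)) = conjS φ := by
  ext y
  rw [fourierS_conjS, fourierS_inversion, conjS_apply]

/-- The map `φ ↦ conj φ̂` is an involution up to reflection-free conjugations, as the preceding
identity shows; this supplies the preimage. -/
theorem exists_fourierS_eq (g : 𝓢(Rn n, ℂ)) : ∃ φ, fourierS φ = g :=
  ⟨conjS (fourierS (conjS g)), by
    rw [fourierS_conjS_fourierS]; ext y; simp⟩

theorem partialFourier_tensorL (f : 𝓢(Rn n, ℂ)) (g : 𝓢(Rn n, ℂ)) :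
    partialFourier (Rn n) n (tensorL f g) = tensorL f (fourierS g) := by
  ext ⟨x, ξ⟩
  rw [partialFourier_apply, tensorL_apply, fourierS_apply]
  simp only [tensorL_apply, mul_left_comm _ (f x)]
  rw [integral_const_mul]
  ring

theorem conjS_partialFourier (f : 𝓢(V × Rn n, ℂ)) :
    conjS (partialFourier V n f) = partialFourierInv V n (conjS f) := by
  ext ⟨v, p⟩
  rw [conjS_apply, partialFourier_apply, partialFourierInv_apply, map_mul, conj_normC,
    ← integral_conj]
  congr 2
  ext y
  simp [← Complex.exp_conj]

theorem conjS_conjS (f : 𝓢(V, ℂ)) : conjS (conjS f) = f := by ext; simp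

theorem conjS_partialFourierInv (f : 𝓢(V × Rn n, ℂ)) :
    conjS (partialFourierInv V n f) = partialFourier V n (conjS f) := by
  rw [← conjS_conjS (partialFourier V n _), conjS_partialFourier, conjS_conjS]

end Inversion

/-! ### The angle `θ₀` and the factorisation of the Wigner transform -/

section Rotation
variable {n : ℕ}

theorem sqrt_seven_mul_theta0 : √7 * theta0 = Real.arccos (3 / 4) := by
  have h : √7 * √7 = (7 : ℝ) := Real.mul_self_sqrt (by norm_num)
  rw [theta0]
  linear_combination (Real.arccos (3 / 4) / 7) * h

/-- Here `cos = 3/4` and `sin / √7 = 1/4`, so the coefficients `cos + sin/√7`, `-2 sin/√7`, `4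
sin/√7`, `cos - sin/√7` are `1`, `-1/2`, `1`, `1/2`. This is the reason for the choice of `θ₀`. -/
theorem rot_neg_theta0 (n : ℕ) : rot n (-theta0) = midMap n := by
  have h7 : (√7 : ℝ) ≠ 0 := by positivity
  have hc : Real.cos (√7 * theta0) = 3 / 4 := by
    rw [sqrt_seven_mul_theta0, Real.cos_arccos (by norm_num) (by norm_num)]
  have hs : Real.sin (√7 * theta0) = √7 / 4 := by
    rw [sqrt_seven_mul_theta0, Real.sin_arccos, Real.sqrt_eq_iff_mul_self_eq (by norm_num)
      (by positivity)]
    have h : √7 * √7 = (7 : ℝ) := Real.mul_self_sqrt (by norm_num)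
    linear_combination -h / 16
  have hs' : Real.sin (√7 * theta0) / √7 = 1 / 4 := by rw [hs]; field_simp
  refine ContinuousLinearEquiv.ext (funext fun z => ?_)
  change rotFun n (-theta0) z = (z.1 - (1 / 2 : ℝ) • z.2, z.1 + (1 / 2 : ℝ) • z.2)
  simp only [rotFun, mul_neg, Real.cos_neg, Real.sin_neg, neg_div, mul_div_assoc, hs', hc]
  ext i <;> simp <;> ring

theorem rot_symm (θ : ℝ) : (rot n θ).symm = rot n (-θ) :=
  ContinuousLinearEquiv.ext rfl

theorem rot_theta0 (n : ℕ) : rot n theta0 = (midMap n).symm := by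
  rw [← rot_neg_theta0, rot_symm, neg_neg]

theorem metaU_metaU_neg (θ : ℝ) (Ψ : 𝓢(Ph n, ℂ)) : metaU n θ (metaU n (-θ) Ψ) = Ψ := by
  simp only [metaU, ContinuousLinearMap.comp_apply, partialFourier_partialFourierInv]
  have h : ∀ Φ : 𝓢(Ph n, ℂ), compLin (rot n (-θ)) (compLin (rot n (- -θ)) Φ) = Φ := by
    intro Φ; ext z
    change Φ (rotFun n (- -θ) (rotFun n (-θ) z)) = Φ z
    rw [rotFun_neg]
  rw [h, partialFourierInv_partialFourier]

theorem metaU_neg_metaU (θ : ℝ) (Ψ : 𝓢(Ph n, ℂ)) : metaU n (-θ) (metaU n θ Ψ) = Ψ := by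
  simpa using metaU_metaU_neg (-θ) Ψ

theorem metaUD_apply (θ : ℝ) (u : 𝓢'(Ph n, ℂ)) (Ξ : 𝓢(Ph n, ℂ)) :
    metaUD n θ u Ξ =
      u (partialFourier (Rn n) n (compLin (rot n θ) (partialFourierInv (Rn n) n Ξ))) := rfl

theorem metaUD_neg_metaUD (θ : ℝ) (u : 𝓢'(Ph n, ℂ)) : metaUD n (-θ) (metaUD n θ u) = u := by
  ext Ξ
  rw [metaUD_apply, metaUD_apply, partialFourierInv_partialFourier]
  have h : ∀ Φ : 𝓢(Ph n, ℂ), compLin (rot n θ) (compLin (rot n (-θ)) Φ) = Φ := by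
    intro Φ; ext z
    change Φ (rotFun n (-θ) (rotFun n θ z)) = Φ z
    rw [rotFun_neg]
  rw [h, partialFourier_partialFourierInv]

/-- The partial Fourier transform acts on the second factor and gives `ψ ⊗ conj φ`; the rotation
inserts the midpoint variables, and `F⁻¹` is the integral over `y`. The prefactor `(2π)^(n/2)`
cancels one of the two factors `normC n` in the Wigner kernel. -/
theorem windWigner_eq (φ ψ : 𝓢(Rn n, ℂ)) :
    windWigner φ ψ = metaU n theta0 (tensorL ψ (conjS (fourierS φ))) := by
  rw [metaU, ContinuousLinearMap.comp_apply, ContinuousLinearMap.comp_apply,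
    partialFourier_tensorL, fourierS_conjS_fourierS, rot_neg_theta0]
  change (((2 * Real.pi) ^ ((n : ℝ) / 2) : ℝ) : ℂ) • (normC n • partialFourierInv (Rn n) n
    (compLin (midMap n) (tensorL ψ (conjS φ)))) = _
  rw [smul_smul, normC, ← Complex.ofReal_mul, ← Real.rpow_add (by positivity), neg_div,
    add_neg_cancel, Real.rpow_zero, Complex.ofReal_one, one_smul]

end Rotation

/-! ### The bilinear pairing and the inner product -/

section Pairing
variable {V : Type} [NormedAddCommGroup V] [NormedSpace ℝ V] [MeasureSpace V] [BorelSpace V]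
  [(volume : Measure V).HasTemperateGrowth]

theorem integrable_mul_schwartz (f g : 𝓢(V, ℂ)) : Integrable fun x => f x * g x :=
  (f.memLp 2).integrable_mul (g.memLp 2)

variable [SecondCountableTopology V]

theorem toD_apply (f g : 𝓢(V, ℂ)) : toD f g = ∫ x, g x * f x := by
  simp [toD]

/-- Reduces unitarity to transposition rules for the bilinear pairing, in which operators move
across without conjugates. -/
theorem inner_toLp (f g : 𝓢(V, ℂ)) : inner ℂ (f.toLp 2) (g.toLp 2) = toD (conjS f) g := by
  rw [L2.inner_def, toD_apply]
  refine integral_congr_ae ?_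
  filter_upwards [f.coeFn_toLp 2, g.coeFn_toLp 2] with x hf hg
  rw [hf, hg]
  rfl

end Pairing

/-! ### Transposes and unitarity -/

section Duality
variable {n : ℕ}

/-- Fubini, since the kernel `e^(-i p·ξ)` is bounded by one and symmetric in `p` and `ξ`. -/
theorem integral_mul_fourierS (f g : 𝓢(Rn n, ℂ)) :
    ∫ ξ, g ξ * fourierS f ξ = ∫ p, fourierS g p * f p := by
  have hint : Integrable (Function.uncurry fun ξ p : Rn n =>
      g ξ * (normC n * (Complex.exp (-(⟪p, ξ⟫ : ℝ) * Complex.I) * f p)))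
      (volume.prod volume) := by
    have h1 : Integrable (fun z : Rn n × Rn n => g z.1 * f z.2) (volume.prod volume) :=
      g.integrable.mul_prod f.integrable
    have h2 := (h1.bdd_mul (c := 1)
      (f := fun z : Rn n × Rn n => Complex.exp (-(⟪z.2, z.1⟫ : ℝ) * Complex.I))
      (Continuous.aestronglyMeasurable (by fun_prop))
      (Filter.Eventually.of_forall fun z => by
        rw [← Complex.ofReal_neg, Complex.norm_exp_ofReal_mul_I])).const_mul (normC n)
    refine h2.congr (Filter.Eventually.of_forall fun z => ?_)
    simp only [Function.uncurry]
    ring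
  simp only [fourierS_apply]
  calc ∫ ξ, g ξ * (normC n * ∫ p, Complex.exp (-(⟪p, ξ⟫ : ℝ) * Complex.I) * f p)
      = ∫ ξ, ∫ p, g ξ * (normC n * (Complex.exp (-(⟪p, ξ⟫ : ℝ) * Complex.I) * f p)) := by
        simp only [integral_const_mul]
    _ = ∫ p, ∫ ξ, g ξ * (normC n * (Complex.exp (-(⟪p, ξ⟫ : ℝ) * Complex.I) * f p)) :=
        integral_integral_swap hint
    _ = _ := by
        congr 1; ext p
        rw [← integral_const_mul, ← integral_mul_const]
        congr 1; ext ξ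
        rw [real_inner_comm]
        ring

theorem toD_prod (f g : 𝓢(Ph n, ℂ)) :
    toD f g = ∫ x : Rn n, ∫ p : Rn n, g (x, p) * f (x, p) := by
  rw [toD_apply]
  exact integral_prod _ (integrable_mul_schwartz g f)

theorem toD_partialFourier (f g : 𝓢(Ph n, ℂ)) :
    toD (partialFourier (Rn n) n f) g = toD f (partialFourier (Rn n) n g) := by
  rw [toD_prod, toD_prod]
  congr 1; ext x
  simp only [partialFourier_eq_fourierS]
  exact integral_mul_fourierS (slice f x) (slice g x)

theorem toD_partialFourierInv (f g : 𝓢(Ph n, ℂ)) :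
    toD (partialFourierInv (Rn n) n f) g = toD f (partialFourierInv (Rn n) n g) := by
  conv_lhs => rw [← partialFourier_partialFourierInv g]
  rw [← toD_partialFourier, partialFourier_partialFourierInv]

/-- The map is a composite of two shears, `(x, y) ↦ (x - y/2, y)` followed by `(x', y) ↦ (x', y +
x')`. The first is a skew product conjugated by the swap. -/
theorem measurePreserving_midMap : MeasurePreserving (midMap n) := by
  have h1 : MeasurePreserving (fun z : Rn n × Rn n => (z.1, z.2 + z.1))
      (volume.prod volume) (volume.prod volume) :=
    (MeasurePreserving.id (volume : Measure (Rn n))).skew_product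
      (g := fun x y => y + x) (by fun_prop)
      (Filter.Eventually.of_forall fun x => map_add_right_eq_self volume x)
  have h2 : MeasurePreserving (fun z : Rn n × Rn n => (z.1, z.2 - (1 / 2 : ℝ) • z.1))
      (volume.prod volume) (volume.prod volume) :=
    (MeasurePreserving.id (volume : Measure (Rn n))).skew_product
      (g := fun x y => y - (1 / 2 : ℝ) • x) (by fun_prop)
      (Filter.Eventually.of_forall fun x => by
        simp only [sub_eq_add_neg]; exact map_add_right_eq_self volume _)
  have h3 : MeasurePreserving (Prod.swap : Rn n × Rn n → Rn n × Rn n)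
      (volume.prod volume) (volume.prod volume) := Measure.measurePreserving_swap
  have h := h1.comp (h3.comp (h2.comp h3))
  convert! h using 1
  ext1 z
  change (z.1 - (1 / 2 : ℝ) • z.2, z.1 + (1 / 2 : ℝ) • z.2) = _
  simp only [Function.comp_apply, Prod.swap]
  ext i <;> simp
  ring

theorem toD_compLin_midMap (f g : 𝓢(Ph n, ℂ)) :
    toD (compLin (midMap n) f) g = toD f (compLin (midMap n).symm g) := by
  rw [toD_apply, toD_apply, ← measurePreserving_midMap.integral_comp
    (midMap n).toHomeomorph.measurableEmbedding fun z => compLin (midMap n).symm g z * f z]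
  congr 1; ext z
  change g z * f (midMap n z) = g ((midMap n).symm (midMap n z)) * f (midMap n z)
  rw [ContinuousLinearEquiv.symm_apply_apply]

/-- Each of the three factors is moved across the pairing. Only the midpoint map has to preserve
measure, since only `±θ₀` occur. -/
theorem metaUD_theta0_toD (Ψ : 𝓢(Ph n, ℂ)) :
    metaUD n theta0 (toD Ψ) = toD (metaU n theta0 Ψ) := by
  ext Ξ
  rw [metaUD_apply, rot_theta0, ← toD_partialFourier, ← toD_compLin_midMap,
    ← toD_partialFourierInv, ← rot_neg_theta0]
  rfl

theorem metaUD_neg_theta0_toD (Ψ : 𝓢(Ph n, ℂ)) :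
    metaUD n (-theta0) (toD Ψ) = toD (metaU n (-theta0) Ψ) := by
  conv_lhs => rw [← metaU_metaU_neg theta0 Ψ, ← metaUD_theta0_toD, metaUD_neg_metaUD]

/-- Conjugation turns `F⁻¹ T F Φ` into `F T F⁻¹ (conj Φ)`; moved across the bilinear pairing, these
factors cancel those of `F⁻¹ T F Ψ` one by one. -/
theorem inner_metaU_theta0 (Φ Ψ : 𝓢(Ph n, ℂ)) :
    inner ℂ ((metaU n theta0 Φ).toLp 2) ((metaU n theta0 Ψ).toLp 2) =
      inner ℂ (Φ.toLp 2) (Ψ.toLp 2) := by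
  rw [inner_toLp, inner_toLp]
  have hc : conjS (metaU n theta0 Φ) = partialFourier (Rn n) n (compLin (midMap n)
      (partialFourierInv (Rn n) n (conjS Φ))) := by
    rw [metaU, rot_neg_theta0, ContinuousLinearMap.comp_apply, ContinuousLinearMap.comp_apply,
      conjS_partialFourierInv, ← conjS_partialFourier]
    rfl
  have hs : ∀ G : 𝓢(Ph n, ℂ), compLin (midMap n).symm (compLin (midMap n) G) = G := fun G => by
    ext z
    change G (midMap n ((midMap n).symm z)) = G z
    rw [ContinuousLinearEquiv.apply_symm_apply]
  rw [hc, toD_partialFourier, metaU, rot_neg_theta0, ContinuousLinearMap.comp_apply,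
    ContinuousLinearMap.comp_apply, partialFourier_partialFourierInv, toD_compLin_midMap, hs,
    toD_partialFourierInv, partialFourierInv_partialFourier]

theorem norm_metaU_theta0 (Ψ : 𝓢(Ph n, ℂ)) :
    ‖(metaU n theta0 Ψ).toLp 2‖ = ‖Ψ.toLp 2‖ := by
  simp_rw [norm_eq_sqrt_re_inner (𝕜 := ℂ), inner_metaU_theta0]

/-- Plancherel: the transform moves from `g` to `conj f̂`, whose Fourier transform is `conj f`. -/
theorem toD_conjS_fourierS (f g : 𝓢(Rn n, ℂ)) :
    toD (conjS (fourierS f)) (fourierS g) = toD (conjS f) g := by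
  rw [toD_apply, toD_apply, ← fourierS_conjS_fourierS f, integral_mul_fourierS]

theorem inner_fourierS (f g : 𝓢(Rn n, ℂ)) :
    inner ℂ ((fourierS f).toLp 2) ((fourierS g).toLp 2) = inner ℂ (f.toLp 2) (g.toLp 2) := by
  rw [inner_toLp, inner_toLp, toD_conjS_fourierS]

theorem norm_fourierS (f : 𝓢(Rn n, ℂ)) : ‖(fourierS f).toLp 2‖ = ‖f.toLp 2‖ := by
  simp_rw [norm_eq_sqrt_re_inner (𝕜 := ℂ), inner_fourierS]

theorem toD_tensorL (f g : 𝓢(Rn n, ℂ)) (Ξ : 𝓢(Ph n, ℂ)) :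
    toD (tensorL f g) Ξ = toD f (contractSnd g Ξ) := by
  rw [toD_prod, toD_apply]
  congr 1; ext x
  rw [contractSnd_apply, ← integral_mul_const]
  congr 1; ext p
  simp only [tensorL_apply]
  ring

theorem toD_tensorR (Ψ : 𝓢(Ph n, ℂ)) (g ξ : 𝓢(Rn n, ℂ)) :
    toD Ψ (tensorR g ξ) = toD (contractSnd g Ψ) ξ := by
  rw [toD_prod, toD_apply]
  congr 1; ext x
  rw [contractSnd_apply, ← integral_const_mul]
  congr 1; ext p
  simp only [tensorR_apply]
  ring

theorem inner_tensorL (f g f' g' : 𝓢(Rn n, ℂ)) :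
    inner ℂ ((tensorL f g).toLp 2) ((tensorL f' g').toLp 2) =
      inner ℂ (f.toLp 2) (f'.toLp 2) * inner ℂ (g.toLp 2) (g'.toLp 2) := by
  simp only [inner_toLp]
  rw [toD_prod, toD_apply, toD_apply, ← integral_mul_const]
  congr 1; ext x
  rw [← integral_const_mul]
  congr 1; ext p
  simp only [tensorL_apply, conjS_apply, map_mul]
  ring

theorem inner_conjS (f g : 𝓢(Rn n, ℂ)) :
    inner ℂ ((conjS f).toLp 2) ((conjS g).toLp 2) = inner ℂ (g.toLp 2) (f.toLp 2) := by
  simp only [inner_toLp, toD_apply, conjS_apply, Complex.conj_conj, mul_comm]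

end Duality

/-! ### The transform `W_φ`, its adjoint and the intertwining relations -/

section Transform
variable {n : ℕ}

theorem windWignerD_toD (φ ψ : 𝓢(Rn n, ℂ)) :
    windWignerD φ (toD ψ) = toD (windWigner φ ψ) := by
  rw [windWigner_eq, ← metaUD_theta0_toD, windWignerD, ContinuousLinearMap.comp_apply]
  congr 1
  ext Ξ
  exact (toD_tensorL ψ _ Ξ).symm

theorem windWignerAdjD_toD (φ : 𝓢(Rn n, ℂ)) (Ψ : 𝓢(Ph n, ℂ)) :
    windWignerAdjD φ (toD Ψ) = toD (windWignerAdj φ Ψ) := by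
  rw [windWignerAdjD, ContinuousLinearMap.comp_apply, metaUD_neg_theta0_toD]
  ext ξ
  exact toD_tensorR _ _ ξ

/-- With `Ψ = ŜΦ`, unitarity removes `Ŝ` from both sides; what remains is that tensoring with `conj
φ̂` and integrating against it are transposes. -/
theorem inner_windWignerAdj (φ ξ : 𝓢(Rn n, ℂ)) (Ψ : 𝓢(Ph n, ℂ)) :
    inner ℂ ((windWignerAdj φ Ψ).toLp 2) (ξ.toLp 2) =
      inner ℂ (Ψ.toLp 2) ((windWigner φ ξ).toLp 2) := by
  conv_rhs => rw [windWigner_eq, ← metaU_metaU_neg theta0 Ψ, inner_metaU_theta0]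
  rw [inner_toLp, inner_toLp]
  set Φ := metaU n (-theta0) Ψ with hΦ
  have h1 : tensorL ξ (conjS (fourierS φ)) = tensorR (conjS (fourierS φ)) ξ := by
    ext z; exact (tensorR_apply _ _ z).symm
  have h2 : conjS (windWignerAdj φ Ψ) = contractSnd (conjS (fourierS φ)) (conjS Φ) := by
    ext x
    rw [conjS_apply, windWignerAdj, ContinuousLinearMap.comp_apply, contractSnd_apply,
      contractSnd_apply, ← integral_conj]
    simp [hΦ]
  rw [h1, toD_tensorR, h2]

/-- Moyal's identity. The windows appear in reversed order because `W_φ` is antilinear in `φ`. -/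
theorem inner_windWigner (φ φ' ψ ψ' : 𝓢(Rn n, ℂ)) :
    inner ℂ ((windWigner φ ψ).toLp 2) ((windWigner φ' ψ').toLp 2) =
      inner ℂ (ψ.toLp 2) (ψ'.toLp 2) * inner ℂ (φ'.toLp 2) (φ.toLp 2) := by
  rw [windWigner_eq, windWigner_eq, inner_metaU_theta0, inner_tensorL, inner_conjS, inner_fourierS]

theorem integral_mul_conj_self {φ : 𝓢(Rn n, ℂ)} (hφ : ‖φ.toLp 2‖ = 1) :
    ∫ p, φ p * (starRingEnd ℂ) (φ p) = 1 := by
  have h : inner ℂ (φ.toLp 2) (φ.toLp 2) = 1 := by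
    rw [inner_self_eq_norm_sq_to_K, hφ]; simp
  rwa [inner_toLp, toD_apply] at h

theorem windWignerAdj_windWigner {φ : 𝓢(Rn n, ℂ)} (hφ : ‖φ.toLp 2‖ = 1) (ψ : 𝓢(Rn n, ℂ)) :
    windWignerAdj φ (windWigner φ ψ) = ψ := by
  rw [windWigner_eq, windWignerAdj, ContinuousLinearMap.comp_apply, metaU_neg_metaU]
  ext x
  rw [contractSnd_apply]
  simp only [tensorL_apply, mul_left_comm _ (ψ x), conjS_apply]
  rw [integral_const_mul, integral_mul_conj_self (by rwa [norm_fourierS]), mul_one]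

variable (a : 𝓢'(Ph n, ℂ))

/-- In distributional form, `Â(ψ ⊗ h) = âψ ⊗ h`: the variable `p` is a spectator and is integrated
out against `h` in the test function. -/
theorem phaseOp_tensorL (ψ h : 𝓢(Rn n, ℂ)) :
    phaseOp a (tensorL ψ h) = PointwiseConvergenceCLM.precomp ℂ (contractSnd h) (weylOp a ψ) := by
  ext Ξ
  change a (wignerKernel n (contractPhase (tensorL ψ h) Ξ)) =
    a (wignerKernel n (tensorL ψ (contractSnd h Ξ)))
  congr 2
  ext ⟨x', x⟩
  rw [contractPhase_apply, tensorL_apply, contractSnd_apply, ← integral_const_mul]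
  simp only [tensorL_apply, mul_assoc]

/-- The transposed form of the same fact: `Â` commutes with integration against `g` in the spectator
variable. -/
theorem precomp_tensorR_phaseOp (g : 𝓢(Rn n, ℂ)) (Ψ : 𝓢(Ph n, ℂ)) :
    PointwiseConvergenceCLM.precomp ℂ (tensorR g) (phaseOp a Ψ) = weylOp a (contractSnd g Ψ) := by
  ext ξ
  change a (wignerKernel n (contractPhase Ψ (tensorR g ξ))) =
    a (wignerKernel n (tensorL (contractSnd g Ψ) ξ))
  congr 2
  ext ⟨x', x⟩
  rw [contractPhase_apply, tensorL_apply, contractSnd_apply, ← integral_mul_const]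
  congr 1; ext p
  rw [tensorR_apply]
  ring

theorem boppOp_windWigner (φ ψ : 𝓢(Rn n, ℂ)) :
    boppOp a (windWigner φ ψ) = windWignerD φ (weylOp a ψ) := by
  change metaUD n theta0 (phaseOp a (metaU n (-theta0) (windWigner φ ψ))) = _
  rw [windWigner_eq, metaU_neg_metaU, phaseOp_tensorL]
  rfl

theorem windWignerAdjD_boppOp (φ : 𝓢(Rn n, ℂ)) (Ψ : 𝓢(Ph n, ℂ)) :
    windWignerAdjD φ (boppOp a Ψ) = weylOp a (windWignerAdj φ Ψ) := by
  change PointwiseConvergenceCLM.precomp ℂ (tensorR (fourierS φ)) (metaUD n (-theta0)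
    (metaUD n theta0 (phaseOp a (metaU n (-theta0) Ψ)))) = _
  rw [metaUD_neg_metaUD, precomp_tensorR_phaseOp]
  rfl

theorem toLp_ne_zero {V : Type} [NormedAddCommGroup V] [NormedSpace ℝ V] [MeasureSpace V]
    [BorelSpace V] [SecondCountableTopology V] [(volume : Measure V).HasTemperateGrowth]
    [(volume : Measure V).IsOpenPosMeasure] {f : 𝓢(V, ℂ)} (hf : f ≠ 0) : f.toLp 2 ≠ 0 := fun h =>
  hf (injective_toLp (F := ℂ) 2 (volume : Measure V) (h.trans (toLpCLM ℂ ℂ 2 volume).map_zero.symm))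

/-- A nonzero Schwartz function can be normalised. -/
theorem exists_norm_smul_eq_one {f : 𝓢(Rn n, ℂ)} (hf : f ≠ 0) :
    ∃ c : ℂ, c ≠ 0 ∧ ‖(c • f).toLp 2‖ = 1 := by
  have h0 := norm_ne_zero_iff.2 (toLp_ne_zero hf)
  refine ⟨((‖f.toLp 2‖⁻¹ : ℝ) : ℂ), by simpa using toLp_ne_zero hf, ?_⟩
  have h : ∀ c : ℂ, (c • f).toLp 2 = c • f.toLp 2 := fun c => (toLpCLM ℂ ℂ 2 volume).map_smul c f
  rw [h, norm_smul, Complex.norm_real, norm_inv, norm_norm, inv_mul_cancel₀ h0]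

theorem fourierS_smul (c : ℂ) (f : 𝓢(Rn n, ℂ)) : fourierS (c • f) = c • fourierS f := by
  ext p
  rw [smul_apply, fourierS_apply, fourierS_apply]
  simp only [smul_apply, smul_eq_mul, mul_left_comm _ c, integral_const_mul]

/-- The adjoints of the windowed Wigner transforms have no common kernel. -/
theorem exists_windWignerAdj_ne_zero {Ψ : 𝓢(Ph n, ℂ)} (hΨ : Ψ ≠ 0) :
    ∃ φ : 𝓢(Rn n, ℂ), ‖φ.toLp 2‖ = 1 ∧ windWignerAdj φ Ψ ≠ 0 := by
  have h0 : metaU n (-theta0) Ψ ≠ 0 := fun h => hΨ (by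
    rw [← metaU_metaU_neg theta0 Ψ, h, map_zero])
  obtain ⟨⟨x, p⟩, hz⟩ : ∃ z, metaU n (-theta0) Ψ z ≠ 0 := by
    by_contra! h
    exact h0 (by ext z; simpa using h z)
  set g := slice (metaU n (-theta0) Ψ) x with hg
  have hg0 : g ≠ 0 := fun h => hz (by
    rw [← slice_apply, ← hg, h, zero_apply])
  -- With this window the value of `W_φ^* Ψ` at `x` is `‖g‖²`, up to the normalising constant.
  obtain ⟨φ, hφ⟩ := exists_fourierS_eq (conjS g)
  have hφ0 : φ ≠ 0 := by
    rintro rfl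
    refine hg0 ?_
    rw [← zero_smul ℂ (0 : 𝓢(Rn n, ℂ)), fourierS_smul, zero_smul] at hφ
    rw [← conjS_conjS g, ← hφ]
    ext; simp
  obtain ⟨c, hc, h1⟩ := exists_norm_smul_eq_one hφ0
  refine ⟨c • φ, h1, fun h => ?_⟩
  have h2 : windWignerAdj (c • φ) Ψ x = c * inner ℂ (g.toLp 2) (g.toLp 2) := by
    rw [windWignerAdj, ContinuousLinearMap.comp_apply, contractSnd_apply, fourierS_smul, hφ,
      inner_toLp, toD_apply, ← integral_const_mul]
    congr 1; ext p
    simp only [smul_apply, smul_eq_mul, hg, slice_apply, conjS_apply]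
    ring
  rw [h, zero_apply] at h2
  have h3 := inner_self_ne_zero (𝕜 := ℂ).2 (toLp_ne_zero hg0)
  exact mul_ne_zero hc h3 h2.symm

end Transform

/-! ### Eigenvalues and eigenfunctions -/

section Eigen
variable {n : ℕ} {a : 𝓢'(Ph n, ℂ)}

theorem windWigner_ne_zero {φ ψ : 𝓢(Rn n, ℂ)} (hφ : ‖φ.toLp 2‖ = 1) (hψ : ψ ≠ 0) :
    windWigner φ ψ ≠ 0 := fun h => hψ (by
  rw [← windWignerAdj_windWigner hφ ψ, h, map_zero])

theorem IsEigenfunction.windWigner {φ ψ : 𝓢(Rn n, ℂ)} {μ : ℂ} (hφ : ‖φ.toLp 2‖ = 1)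
    (h : IsEigenfunction (weylOp a) μ ψ) :
    IsEigenfunction (boppOp a) μ (Bopp.windWigner φ ψ) := by
  refine ⟨windWigner_ne_zero hφ h.1, ?_⟩
  rw [boppOp_windWigner, h.2, map_smul, windWignerD_toD]

theorem IsEigenfunction.windWignerAdj {φ : 𝓢(Rn n, ℂ)} {Ψ : 𝓢(Ph n, ℂ)} {μ : ℂ}
    (h : IsEigenfunction (boppOp a) μ Ψ) (h0 : Bopp.windWignerAdj φ Ψ ≠ 0) :
    IsEigenfunction (weylOp a) μ (Bopp.windWignerAdj φ Ψ) := by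
  refine ⟨h0, ?_⟩
  rw [← windWignerAdjD_boppOp, h.2, map_smul, windWignerAdjD_toD]

variable (a) in
theorem isEigenvalue_weylOp_iff (μ : ℂ) :
    IsEigenvalue (weylOp a) μ ↔ IsEigenvalue (boppOp a) μ := by
  constructor
  · rintro ⟨ψ, hψ⟩
    -- Any unit window would do; the normalised eigenfunction is one at hand.
    obtain ⟨c, -, hc⟩ := exists_norm_smul_eq_one hψ.1
    exact ⟨_, hψ.windWigner hc⟩
  · rintro ⟨Ψ, hΨ⟩
    obtain ⟨φ, -, h0⟩ := exists_windWignerAdj_ne_zero hΨ.1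
    exact ⟨_, hΨ.windWignerAdj h0⟩

end Eigen

/-! ### Solutions and their uniqueness -/

section Evolution
variable {V : Type} [NormedAddCommGroup V] [NormedSpace ℝ V] [MeasureSpace V] [BorelSpace V]
  [SecondCountableTopology V] [(volume : Measure V).HasTemperateGrowth]
  {T : 𝓢(V, ℂ) →ₗ[ℂ] 𝓢'(V, ℂ)} {J : Set ℝ} {u₀ v₀ : 𝓢(V, ℂ)} {u v : ℝ → 𝓢(V, ℂ)}

theorem IsSolution.add (hu : IsSolution T J u₀ u) (hv : IsSolution T J v₀ v) :
    IsSolution T J (u₀ + v₀) (u + v) := by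
  refine ⟨by rw [Pi.add_apply, hu.1, hv.1], fun t ht ξ => ?_⟩
  have h := (hu.2 t ht ξ).add (hv.2 t ht ξ)
  rw [Pi.add_apply, map_add]
  refine (h.congr_deriv rfl).congr_of_eventuallyEq (Filter.Eventually.of_forall fun s => ?_) ?_
  all_goals
    simp only [Pi.add_apply, toD, map_add, ← mul_add]
    rfl

theorem IsSolution.neg (hu : IsSolution T J u₀ u) : IsSolution T J (-u₀) (-u) := by
  refine ⟨by rw [Pi.neg_apply, hu.1], fun t ht ξ => ?_⟩
  have h := (hu.2 t ht ξ).neg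
  rw [Pi.neg_apply, map_neg]
  refine (h.congr_deriv rfl).congr_of_eventuallyEq (Filter.Eventually.of_forall fun s => ?_) ?_
  all_goals
    simp only [Pi.neg_apply, toD, map_neg, ← mul_neg]
    rfl

theorem IsSolution.sub (hu : IsSolution T J u₀ u) (hv : IsSolution T J v₀ v) :
    IsSolution T J (u₀ - v₀) (u - v) := by
  rw [sub_eq_add_neg, sub_eq_add_neg]
  exact hu.add hv.neg

/-- A solution with zero initial data vanishes if some problem has only one solution. -/
theorem IsUniqueSolution.eq_zero (hu : IsUniqueSolution T J u₀ u) (hv : IsSolution T J 0 v)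
    {t : ℝ} (ht : t ∈ J) : v t = 0 := by
  have h := hu.2 _ (by simpa using hu.1.add hv) ht
  simpa using h

variable {n : ℕ} {a : 𝓢'(Ph n, ℂ)}

/-- Since `W_φ` on distributions is defined by duality, testing `W_φ ψ(s)` with `Ξ` is testing
`ψ(s)` with a Schwartz function independent of `s`, so the weak derivative carries over. -/
theorem IsSolution.windWigner (φ : 𝓢(Rn n, ℂ)) {ψ₀ : 𝓢(Rn n, ℂ)} {ψ : ℝ → 𝓢(Rn n, ℂ)}
    (h : IsSolution (weylOp a) J ψ₀ ψ) :
    IsSolution (boppOp a) J (Bopp.windWigner φ ψ₀) fun t => Bopp.windWigner φ (ψ t) := by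
  refine ⟨by simp only [h.1], fun t ht Ξ => ?_⟩
  simp only [boppOp_windWigner, ← windWignerD_toD]
  exact h.2 t ht _

theorem IsSolution.windWignerAdj (φ : 𝓢(Rn n, ℂ)) {Ψ₀ : 𝓢(Ph n, ℂ)} {Ψ : ℝ → 𝓢(Ph n, ℂ)}
    (h : IsSolution (boppOp a) J Ψ₀ Ψ) :
    IsSolution (weylOp a) J (Bopp.windWignerAdj φ Ψ₀) fun t => Bopp.windWignerAdj φ (Ψ t) := by
  refine ⟨by simp only [h.1], fun t ht ξ => ?_⟩
  simp only [← windWignerAdjD_boppOp, ← windWignerAdjD_toD]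
  exact h.2 t ht _

/-- If another solution differed at time `t`, some `W_φ'^*` would not kill the difference there,
giving a nonzero solution for `â` with zero initial data. The window `φ'` is adapted to that
difference, because `W_φ^*` itself may vanish on it. -/
theorem IsUniqueSolution.windWigner (φ : 𝓢(Rn n, ℂ)) {ψ₀ : 𝓢(Rn n, ℂ)} {ψ : ℝ → 𝓢(Rn n, ℂ)}
    (h : IsUniqueSolution (weylOp a) J ψ₀ ψ) :
    IsUniqueSolution (boppOp a) J (Bopp.windWigner φ ψ₀) fun t => Bopp.windWigner φ (ψ t) := by
  refine ⟨h.1.windWigner φ, fun Ψ hΨ t ht => ?_⟩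
  by_contra hne
  obtain ⟨φ', -, h0⟩ := exists_windWignerAdj_ne_zero (sub_ne_zero.2 hne)
  have h1 := ((h.1.windWigner φ).sub hΨ).windWignerAdj φ'
  rw [sub_self, map_zero] at h1
  exact h0 (h.eq_zero h1 ht)

/-- Here one window suffices: `W_φ` is injective and sends a difference of solutions for `â` to a
solution for `Â_B` with zero initial data. -/
theorem IsUniqueSolution.windWignerAdj {φ : 𝓢(Rn n, ℂ)} (hφ : ‖φ.toLp 2‖ = 1)
    {Ψ₀ : 𝓢(Ph n, ℂ)} {Ψ : ℝ → 𝓢(Ph n, ℂ)} (h : IsUniqueSolution (boppOp a) J Ψ₀ Ψ) :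
    IsUniqueSolution (weylOp a) J (Bopp.windWignerAdj φ Ψ₀)
      fun t => Bopp.windWignerAdj φ (Ψ t) := by
  refine ⟨h.1.windWignerAdj φ, fun ψ hψ t ht => ?_⟩
  by_contra hne
  have h1 := ((h.1.windWignerAdj φ).sub hψ).windWigner φ
  rw [sub_self, map_zero] at h1
  exact windWigner_ne_zero hφ (sub_ne_zero.2 hne) (h.eq_zero h1 ht)

end Evolution

/-! ### Total families in `L²` -/

/-- Orthonormal vectors are `√2` apart, so the balls of radius `1/2` around them are disjoint.
Countability later allows the union of one null set for each window. -/
theorem countable_of_orthonormal {H ι : Type*} [NormedAddCommGroup H] [InnerProductSpace ℂ H]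
    [SecondCountableTopology H] {e : ι → H} (he : Orthonormal ℂ e) : Countable ι := by
  rw [← Set.countable_univ_iff]
  refine Set.PairwiseDisjoint.countable_of_isOpen (s := fun i => Metric.ball (e i) (1 / 2))
    (fun i _ j _ hij => ?_) (fun _ _ => Metric.isOpen_ball)
    (fun i _ => ⟨e i, Metric.mem_ball_self (by norm_num)⟩)
  refine Metric.ball_disjoint_ball ?_
  have h := norm_sub_sq (𝕜 := ℂ) (e i) (e j)
  rw [he.2 hij, he.1 i, he.1 j] at h
  rw [dist_eq_norm]
  simp at h
  nlinarith [norm_nonneg (e i - e j)]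

section Total
variable {V V' : Type} [NormedAddCommGroup V] [NormedSpace ℝ V] [MeasureSpace V] [BorelSpace V]
  [SecondCountableTopology V] [(volume : Measure V).HasTemperateGrowth]
  [NormedAddCommGroup V'] [NormedSpace ℝ V'] [MeasureSpace V'] [BorelSpace V']
  [SecondCountableTopology V'] [(volume : Measure V').HasTemperateGrowth]
  [FiniteDimensional ℝ V'] [IsFiniteMeasureOnCompacts (volume : Measure V')] {ι : Type*}

/-- A family of Schwartz functions whose span is dense in `L²`. -/
def IsTotal {V : Type} [NormedAddCommGroup V] [NormedSpace ℝ V] [MeasureSpace V] [BorelSpace V]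
    [SecondCountableTopology V] [(volume : Measure V).HasTemperateGrowth]
    (e : ι → 𝓢(V, ℂ)) : Prop :=
  (Submodule.span ℂ (Set.range fun i => (e i).toLp 2)).topologicalClosure = ⊤

theorem isTotal_iff (e : ι → 𝓢(V, ℂ)) :
    IsTotal e ↔ ∀ G : Lp ℂ 2 (volume : Measure V), (∀ i, inner ℂ ((e i).toLp 2) G = 0) → G = 0 := by
  rw [IsTotal, Submodule.topologicalClosure_eq_top_iff, Submodule.eq_bot_iff]
  refine forall_congr' fun G => imp_congr_left ?_
  rw [Submodule.mem_orthogonal]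
  refine ⟨fun h i => h _ (Submodule.subset_span ⟨i, rfl⟩), fun h u hu => ?_⟩
  induction hu using Submodule.span_induction with
  | mem x hx => obtain ⟨i, rfl⟩ := hx; exact h i
  | zero => exact inner_zero_left _
  | add x y _ _ hx hy => rw [inner_add_left, hx, hy, add_zero]
  | smul c x _ hx => rw [inner_smul_left, hx, mul_zero]

/-- A surjective isometry of Schwartz spaces maps total families to total families. -/
theorem IsTotal.map {σ : ℂ →+* ℂ} [RingHomSurjective σ] {e : ι → 𝓢(V, ℂ)} (he : IsTotal e)
    (U : 𝓢(V, ℂ) →ₛₗ[σ] 𝓢(V', ℂ)) (hU : Function.Surjective U)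
    (hn : ∀ f, ‖(U f).toLp 2‖ = ‖f.toLp 2‖) : IsTotal fun i => U (e i) := by
  -- Elements of the span are classes of Schwartz functions, so `U` can be applied to approximants
  -- without being extended to `L²`. The map may be semilinear, as `φ ↦ conj φ̂` requires.
  have hspan : ∀ {W : Type} [NormedAddCommGroup W] [NormedSpace ℝ W] [MeasureSpace W]
      [BorelSpace W] [SecondCountableTopology W] [(volume : Measure W).HasTemperateGrowth]
      (d : ι → 𝓢(W, ℂ)), Submodule.span ℂ (Set.range fun i => (d i).toLp 2) =
        (Submodule.span ℂ (Set.range d)).map (toLpCLM ℂ ℂ 2 (volume : Measure W)).toLinearMap := by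
    intro W _ _ _ _ _ _ d
    rw [Submodule.map_span, ← Set.range_comp]
    rfl
  have hU' : ∀ g, (U g).toLp 2 ∈
      (Submodule.span ℂ (Set.range fun i => (U (e i)).toLp 2)).topologicalClosure := by
    intro g
    rw [← SetLike.mem_coe, Submodule.topologicalClosure_coe, Metric.mem_closure_iff]
    intro ε hε
    have hg : g.toLp 2 ∈ (Submodule.span ℂ
        (Set.range fun i => (e i).toLp 2)).topologicalClosure := by
      rw [show _ = ⊤ from he]; trivial
    rw [← SetLike.mem_coe, Submodule.topologicalClosure_coe, Metric.mem_closure_iff] at hg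
    obtain ⟨b, hb, hd⟩ := hg ε hε
    rw [hspan] at hb
    obtain ⟨s, hs, rfl⟩ := hb
    refine ⟨(U s).toLp 2, ?_, ?_⟩
    · rw [hspan]
      refine ⟨U s, ?_, rfl⟩
      have h : U s ∈ (Submodule.span ℂ (Set.range e)).map U := ⟨s, hs, rfl⟩
      rw [Submodule.map_span, ← Set.range_comp] at h
      exact h
    · rw [dist_eq_norm] at hd ⊢
      have h1 : (U g).toLp 2 volume - (U s).toLp 2 volume = (U (g - s)).toLp 2 volume := by
        rw [map_sub]; exact ((toLpCLM ℂ ℂ 2 (volume : Measure V')).map_sub _ _).symm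
      have h2 : g.toLp 2 volume - toLpCLM ℂ ℂ 2 (volume : Measure V) s = (g - s).toLp 2 volume :=
        ((toLpCLM ℂ ℂ 2 (volume : Measure V)).map_sub _ _).symm
      rw [h1, hn, ← h2]
      exact hd
  refine SetLike.coe_injective (Set.eq_univ_of_univ_subset ?_)
  -- Schwartz functions are dense in `L²`, so it is enough that the closed span contains them; by
  -- surjectivity each is some `U g`.
  rw [← (denseRange_toLpCLM (E := V') (F := ℂ) (p := 2) (μ := volume) (by simp)).closure_range]
  refine closure_minimal ?_ (Submodule.isClosed_topologicalClosure _)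
  rintro _ ⟨f, rfl⟩
  obtain ⟨g, rfl⟩ := hU f
  exact hU' g

end Total

/-! ### Completeness of tensor products -/

section Tensor
variable {n : ℕ} {ι κ : Type*}

theorem inner_toLp_memLp {V : Type} [NormedAddCommGroup V] [NormedSpace ℝ V] [MeasureSpace V]
    [BorelSpace V] [SecondCountableTopology V] [(volume : Measure V).HasTemperateGrowth]
    (f : 𝓢(V, ℂ)) {g : V → ℂ} (hg : MemLp g 2) :
    inner ℂ (f.toLp 2) (hg.toLp g) = ∫ x, (starRingEnd ℂ) (f x) * g x := by
  rw [L2.inner_def]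
  refine integral_congr_ae ?_
  filter_upwards [f.coeFn_toLp 2, hg.coeFn_toLp] with x hf hgx
  rw [hf, hgx]
  exact mul_comm _ _

theorem norm_sq_toLp {V : Type} [MeasureSpace V] {g : V → ℂ} (hg : MemLp g 2) :
    ‖hg.toLp g‖ ^ 2 = ∫ x, ‖g x‖ ^ 2 := by
  have h : (inner ℂ (hg.toLp g) (hg.toLp g)) = ((∫ x, ‖g x‖ ^ 2 : ℝ) : ℂ) := by
    rw [L2.inner_def, ← integral_complex_ofReal]
    refine integral_congr_ae ?_
    filter_upwards [hg.coeFn_toLp] with x hx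
    rw [hx, inner_self_eq_norm_sq_to_K]
    simp
  rw [inner_self_eq_norm_sq_to_K] at h
  exact Complex.ofReal_injective (by simpa using h)

theorem ae_memLp_slice {G : Ph n → ℂ} (hG : MemLp G 2) :
    ∀ᵐ x : Rn n, MemLp (fun p : Rn n => G (x, p)) 2 := by
  have h1 := ((memLp_two_iff_integrable_sq_norm hG.1).1 hG).prod_right_ae
  have h2 : ∀ᵐ x : Rn n, AEStronglyMeasurable (fun p : Rn n => G (x, p)) volume :=
    hG.1.prodMk_left
  filter_upwards [h1, h2] with x hx hm
  exact (memLp_two_iff_integrable_sq_norm hm).2 hx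

/-- Cauchy–Schwarz in `p` bounds the squared integral by `‖h‖² ‖G(x, ·)‖²` for almost every `x`, and
the bound is integrable in `x` by Fubini. -/
theorem memLp_contract (h : 𝓢(Rn n, ℂ)) {G : Ph n → ℂ} (hG : MemLp G 2) :
    MemLp (fun x : Rn n => ∫ p : Rn n, (starRingEnd ℂ) (h p) * G (x, p)) 2 := by
  have hm : AEStronglyMeasurable (fun x : Rn n => ∫ p : Rn n, (starRingEnd ℂ) (h p) * G (x, p))
      volume := by
    have hc : Continuous fun z : Ph n => (starRingEnd ℂ) (h z.2) :=
      Complex.continuous_conj.comp (h.continuous.comp continuous_snd)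
    exact (hc.aestronglyMeasurable.mul hG.1).integral_prod_right'
  rw [memLp_two_iff_integrable_sq_norm hm]
  have hi := (((memLp_two_iff_integrable_sq_norm hG.1).1 hG).integral_prod_left).const_mul
    (‖h.toLp 2‖ ^ 2)
  refine hi.mono' (hm.norm.pow 2) ?_
  filter_upwards [ae_memLp_slice hG] with x hx
  rw [Real.norm_of_nonneg (by positivity), ← inner_toLp_memLp h hx, ← norm_sq_toLp hx, ← mul_pow]
  exact pow_le_pow_left₀ (norm_nonneg _) (norm_inner_le_norm _ _) 2

theorem inner_tensorL_memLp (f h : 𝓢(Rn n, ℂ)) {G : Ph n → ℂ} (hG : MemLp G 2) :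
    inner ℂ ((tensorL f h).toLp 2) (hG.toLp G) =
      inner ℂ (f.toLp 2) ((memLp_contract h hG).toLp _) := by
  rw [inner_toLp_memLp, inner_toLp_memLp]
  have hi : Integrable (fun z : Ph n => (starRingEnd ℂ) (tensorL f h z) * G z)
      (volume.prod volume) := ((conjS (tensorL f h)).memLp 2).integrable_mul hG
  refine (integral_prod _ hi).trans ?_
  congr 1; ext x
  rw [← integral_const_mul]
  congr 1; ext p
  simp only [tensorL_apply, map_mul, mul_assoc]

/-- The tensor products of two total families form a total family. -/
theorem IsTotal.tensorL [Countable κ] {e : ι → 𝓢(Rn n, ℂ)} {h : κ → 𝓢(Rn n, ℂ)}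
    (he : IsTotal e) (hh : IsTotal h) :
    IsTotal fun q : κ × ι => Bopp.tensorL (e q.2) (h q.1) := by
  rw [isTotal_iff] at he hh ⊢
  intro G' hG'
  obtain ⟨G, hG, rfl⟩ : ∃ (G : Ph n → ℂ) (hG : MemLp G 2 volume), G' = hG.toLp G :=
    ⟨G', Lp.memLp G', (Lp.toLp_coeFn _ _).symm⟩
  -- For fixed `k` the contraction of `G` with `h k` is orthogonal to every `e i`, hence zero almost
  -- everywhere.
  have h1 : ∀ k, ∀ᵐ x : Rn n, ∫ p : Rn n, (starRingEnd ℂ) (h k p) * G (x, p) = 0 := by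
    intro k
    have h2 := he ((memLp_contract (h k) hG).toLp _) fun i => by
      rw [← inner_tensorL_memLp]; exact hG' (k, i)
    filter_upwards [(memLp_contract (h k) hG).coeFn_toLp, Lp.coeFn_zero ℂ 2 volume] with x hx h0
    rw [← hx, h2, h0]; rfl
  -- As `κ` is countable, one null set serves all `k`; off it the slice `G(x, ·)` is orthogonal to
  -- every `h k` and so vanishes in `L²`.
  have h3 : ∀ᵐ x : Rn n, ∫ p : Rn n, ‖G (x, p)‖ ^ 2 = 0 := by
    filter_upwards [ae_all_iff.2 h1, ae_memLp_slice hG] with x hx hm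
    rw [← norm_sq_toLp hm, hh (hm.toLp _) fun k => by rw [inner_toLp_memLp, hx k]]
    simp
  have h4 : ‖hG.toLp G‖ ^ 2 = 0 := by
    rw [norm_sq_toLp hG]
    refine (integral_prod _ ((memLp_two_iff_integrable_sq_norm hG.1).1 hG)).trans ?_
    rw [integral_congr_ae h3]
    simp
  exact norm_eq_zero.1 (pow_eq_zero_iff two_ne_zero |>.1 h4)

end Tensor

/-! ### The basis of windowed Wigner transforms -/

section Basis
variable {n : ℕ} {ι κ : Type*}

theorem conjS_add {V : Type} [NormedAddCommGroup V] [NormedSpace ℝ V] (f g : 𝓢(V, ℂ)) :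
    conjS (f + g) = conjS f + conjS g := by
  ext; simp

theorem fourierS_add (f g : 𝓢(Rn n, ℂ)) : fourierS (f + g) = fourierS f + fourierS g := by
  have h : 𝓕 (f + g) = 𝓕 f + 𝓕 g := FourierTransform.fourier_add f g
  simp only [fourierS, h, map_add, smul_add]

/-- The antilinear map `φ ↦ conj φ̂`. -/
def conjFourier (n : ℕ) : 𝓢(Rn n, ℂ) →ₛₗ[starRingEnd ℂ] 𝓢(Rn n, ℂ) where
  toFun φ := conjS (fourierS φ)
  map_add' f g := by rw [fourierS_add, conjS_add]
  map_smul' c f := by rw [fourierS_smul]; ext; simp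

theorem conjFourier_apply (φ : 𝓢(Rn n, ℂ)) : conjFourier n φ = conjS (fourierS φ) := rfl

theorem norm_conjFourier (φ : 𝓢(Rn n, ℂ)) : ‖(conjFourier n φ).toLp 2‖ = ‖φ.toLp 2‖ := by
  rw [conjFourier_apply, ← norm_fourierS φ]
  simp_rw [norm_eq_sqrt_re_inner (𝕜 := ℂ), inner_conjS]

theorem conjFourier_surjective : Function.Surjective (conjFourier n) := fun g => by
  obtain ⟨φ, hφ⟩ := exists_fourierS_eq (conjS g)
  exact ⟨φ, by rw [conjFourier_apply, hφ, conjS_conjS]⟩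

/-- Orthonormality is Moyal's identity. For completeness the antiunitary `φ ↦ conj φ̂` keeps the
windows total, their tensor products with the `ψ i` are total, and `Ŝ` maps these onto the family in
question. -/
theorem IsONBasis.windWigner {ψ : ι → 𝓢(Rn n, ℂ)} {φ : κ → 𝓢(Rn n, ℂ)} (hψ : IsONBasis ψ)
    (hφ : IsONBasis φ) :
    IsONBasis fun q : κ × ι => Bopp.windWigner (φ q.1) (ψ q.2) := by
  classical
  constructor
  · rw [orthonormal_iff_ite]
    intro q r
    rw [inner_windWigner, orthonormal_iff_ite.1 hψ.1, orthonormal_iff_ite.1 hφ.1]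
    by_cases h1 : q.1 = r.1 <;> by_cases h2 : q.2 = r.2 <;> simp [Prod.ext_iff, h1, h2, eq_comm]
  -- Lets instance search find that `L²` is second countable, for the countability of `κ`.
  · have : Fact ((2 : ENNReal) ≠ ⊤) := ⟨ENNReal.ofNat_ne_top⟩
    have : Countable κ := countable_of_orthonormal hφ.1
    have h1 : IsTotal fun k => conjFourier n (φ k) :=
      IsTotal.map hφ.2 _ conjFourier_surjective norm_conjFourier
    have h2 := (IsTotal.tensorL hψ.2 h1).map (metaU n theta0).toLinearMap
      (fun Ψ => ⟨metaU n (-theta0) Ψ, metaU_metaU_neg theta0 Ψ⟩) norm_metaU_theta0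
    simp_rw [windWigner_eq]
    exact h2

end Basis

end Bopp

end

theorem mainTheorem3 (n : ℕ) (a : 𝓢'(Bopp.Ph n, ℂ)) :
    -- the eigenvalues of the two operators are the same
    (∀ μ : ℂ, Bopp.IsEigenvalue (Bopp.weylOp a) μ ↔ Bopp.IsEigenvalue (Bopp.boppOp a) μ) ∧
    (∀ φ : 𝓢(Bopp.Rn n, ℂ), ‖φ.toLp 2‖ = 1 →
      -- the maps on tempered distributions extend the maps on Schwartz functions
      (∀ ψ, Bopp.windWignerD φ (Bopp.toD ψ) = Bopp.toD (Bopp.windWigner φ ψ)) ∧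
      (∀ Ψ, Bopp.windWignerAdjD φ (Bopp.toD Ψ) = Bopp.toD (Bopp.windWignerAdj φ Ψ)) ∧
      -- `W_φ^*` is the adjoint of `W_φ`, and a left inverse
      (∀ (Ψ : 𝓢(Bopp.Ph n, ℂ)) (ξ : 𝓢(Bopp.Rn n, ℂ)),
        inner ℂ ((Bopp.windWignerAdj φ Ψ).toLp 2) (ξ.toLp 2) =
          inner ℂ (Ψ.toLp 2) ((Bopp.windWigner φ ξ).toLp 2)) ∧
      (∀ ψ, Bopp.windWignerAdj φ (Bopp.windWigner φ ψ) = ψ) ∧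
      -- intertwining relations
      (∀ ψ, Bopp.boppOp a (Bopp.windWigner φ ψ) = Bopp.windWignerD φ (Bopp.weylOp a ψ)) ∧
      (∀ Ψ, Bopp.windWignerAdjD φ (Bopp.boppOp a Ψ) = Bopp.weylOp a (Bopp.windWignerAdj φ Ψ)) ∧
      -- correspondence of eigenfunctions
      (∀ μ ψ, Bopp.IsEigenfunction (Bopp.weylOp a) μ ψ →
        Bopp.IsEigenfunction (Bopp.boppOp a) μ (Bopp.windWigner φ ψ)) ∧
      (∀ μ Ψ, Bopp.IsEigenfunction (Bopp.boppOp a) μ Ψ → Bopp.windWignerAdj φ Ψ ≠ 0 →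
        Bopp.IsEigenfunction (Bopp.weylOp a) μ (Bopp.windWignerAdj φ Ψ)) ∧
      -- correspondence of the time evolutions
      (∀ J : Set ℝ, J.OrdConnected → 0 ∈ J →
        (∀ ψ₀ ψ, Bopp.IsSolution (Bopp.weylOp a) J ψ₀ ψ →
          Bopp.IsSolution (Bopp.boppOp a) J (Bopp.windWigner φ ψ₀)
            (fun t => Bopp.windWigner φ (ψ t))) ∧
        (∀ ψ₀ ψ, Bopp.IsUniqueSolution (Bopp.weylOp a) J ψ₀ ψ →
          Bopp.IsUniqueSolution (Bopp.boppOp a) J (Bopp.windWigner φ ψ₀)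
            (fun t => Bopp.windWigner φ (ψ t))) ∧
        (∀ Ψ₀ Ψ, Bopp.IsSolution (Bopp.boppOp a) J Ψ₀ Ψ →
          Bopp.IsSolution (Bopp.weylOp a) J (Bopp.windWignerAdj φ Ψ₀)
            (fun t => Bopp.windWignerAdj φ (Ψ t))) ∧
        (∀ Ψ₀ Ψ, Bopp.IsUniqueSolution (Bopp.boppOp a) J Ψ₀ Ψ →
          Bopp.IsUniqueSolution (Bopp.weylOp a) J (Bopp.windWignerAdj φ Ψ₀)
            (fun t => Bopp.windWignerAdj φ (Ψ t))))) ∧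
    -- orthonormal eigenbases
    (∀ {ι κ : Type*} (ψ : ι → 𝓢(Bopp.Rn n, ℂ)) (μ : ι → ℂ) (φ : κ → 𝓢(Bopp.Rn n, ℂ)),
      (∀ i, Bopp.IsEigenfunction (Bopp.weylOp a) (μ i) (ψ i)) → Bopp.IsONBasis ψ →
      Bopp.IsONBasis φ →
      (∀ k i, Bopp.IsEigenfunction (Bopp.boppOp a) (μ i) (Bopp.windWigner (φ k) (ψ i))) ∧
      Bopp.IsONBasis (fun q : κ × ι => Bopp.windWigner (φ q.1) (ψ q.2))) := by
  refine ⟨Bopp.isEigenvalue_weylOp_iff a, fun φ hφ => ⟨Bopp.windWignerD_toD φ,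
    Bopp.windWignerAdjD_toD φ, fun Ψ ξ => Bopp.inner_windWignerAdj φ ξ Ψ,
    Bopp.windWignerAdj_windWigner hφ, Bopp.boppOp_windWigner a φ, Bopp.windWignerAdjD_boppOp a φ,
    fun μ ψ h => h.windWigner hφ, fun μ Ψ h h0 => h.windWignerAdj h0,
    fun J _ _ => ⟨fun ψ₀ ψ h => h.windWigner φ, fun ψ₀ ψ h => h.windWigner φ,
      fun Ψ₀ Ψ h => h.windWignerAdj φ, fun Ψ₀ Ψ h => h.windWignerAdj hφ⟩⟩,
    -- Members of an orthonormal family are unit vectors, hence admissible windows.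
    fun ψ μ φ h hψ hφ => ⟨fun k i => (h i).windWigner (hφ.1.1 k), hψ.windWigner hφ⟩⟩
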